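/- Let $d\ge 2$, let $f$ be a probability density on $\mathbb{R}^d$, $c\in\mathbb{R}$, and let $\mathcal{M}=\{x\in\mathbb{R}^d: f(x)=c\}$ be compact. Let $\mathscr{H}$ denote the $(d-1)$-dimensional Hausdorff measure on $\mathbb{R}^d$, normalized to agree with Lebesgue measure on $(d-1)$-dimensional planes. Let $\nu\ge 2$ be an integer and assume the following. (F1) There are $\delta_0,\epsilon_0>0$ such that $f$ has continuous partial derivatives up to order $\nu$ on $\{x: |f(x)-c|\le 2\delta_0\}$ and $\|\nabla f(x)\|>\epsilon_0$ for all $x$ in this set. (K) $K:\mathbb{R}^d\to\mathbb{R}$ is twice continuously differentiable with bounded support, and is a kernel of order $\nu$: $\int_{\mathbb{R}^d} K(u)\,du=1$, $\int_{\mathbb{R}^d} u^{\otimes l}K(u)\,du=0$ for $l=1,\dots,\nu-1$, and $\int_{\mathbb{R}^d} u^{\otimes \nu}K(u)\,du\neq 0$. Let $X_1,X_2,\dots$ be i.i.d. with density $f$, let $h=h_n>0$ be bandwidths, and let $$\widehat f(x)=\frac{1}{nh^d}\sum_{i=1}^n K\Big(\frac{x-X_i}{h}\Big)$$ be the kernel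 density estimator. For $x\in\mathcal{M}$ let $\mathbf{N}(x)=\nabla f(x)/\|\nabla f(x)\|$, let $T_x=\{y\in\mathbb{R}^d:\langle y,\nabla f(x)\rangle=0\}$ be the tangent space of $\mathcal{M}$ at $x$, and for $t\in\mathbb{R}$ let $T_{x,t}=\{y+t\mathbf{N}(x): y\in T_x\}$. Put $$R_K(x)=\int_{\mathbb{R}}\Big(\int_{T_{x,t}}K(u)\,d\mathscr{H}(u)\Big)^2dt .$$ Let $w:\mathcal{M}\to\mathbb{R}$ be bounded and continuous. If $nh\to\infty$ and $h\to0$ as $n\to\infty$, then $$\sqrt{nh}\int_{\mathcal{M}} w(x)\,\big[\widehat f(x)-\mathbb{E}\widehat f(x)\big]\,d\mathscr{H}(x)\ \longrightarrow_D\ \mathscr{N}(0,\sigma^2),\qquad \sigma^2=c\int_{\mathcal{M}}w(x)^2R_K(x)\,d\mathscr{H}(x),$$ where all integrands are integrable, $0\le\sigma^2<\infty$, and $\mathscr{N}(0,0)$ is the point mass at $0$. -/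

import Mathlib

open MeasureTheory ProbabilityTheory Filter Topology

noncomputable section

namespace LevelSetKDE

/-- Euclidean space `ℝ^d`. -/
abbrev Eucl (d : ℕ) : Type := EuclideanSpace ℝ (Fin d)

/-- The `c`-level set of `f`. -/
def levelSet {d : ℕ} (f : Eucl d → ℝ) (c : ℝ) : Set (Eucl d) := f ⁻¹' {c}

/-- `f⁻¹([c - δ, c + δ])`. -/
def levelBand {d : ℕ} (f : Eucl d → ℝ) (c δ : ℝ) : Set (Eucl d) :=
  f ⁻¹' Set.Icc (c - δ) (c + δ)

/-- The surface integral of `g` over the `c`-level set of `f`, with respect to the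
`(d-1)`-dimensional Hausdorff measure normalized to agree with Lebesgue measure in dimension
`d - 1`. -/
def surfaceIntegral {d : ℕ} (f : Eucl d → ℝ) (c : ℝ) (g : Eucl d → ℝ) : ℝ :=
  ∫ x in levelSet f c, g x ∂μHE[d - 1]

/-- The entries of `∫ u^{⊗ l} K(u) du`, indexed by `i : Fin l → Fin d`. -/
def kernelMoment {d : ℕ} (K : Eucl d → ℝ) (l : ℕ) (i : Fin l → Fin d) : ℝ :=
  ∫ u : Eucl d, (∏ j, u (i j)) * K u

/-- `K` is a twice continuously differentiable kernel of order `ν ≥ 2` with bounded support. -/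
structure KernelAssumption {d : ℕ} (K : Eucl d → ℝ) (ν : ℕ) : Prop where
  two_le_order : 2 ≤ ν
  contDiff : ContDiff ℝ 2 K
  hasCompactSupport : HasCompactSupport K
  integral_eq_one : ∫ u, K u = 1
  moment_eq_zero : ∀ l : ℕ, 1 ≤ l → l < ν → kernelMoment K l = 0
  moment_ne_zero : kernelMoment K ν ≠ 0

/-- For some `δ₀, ε₀ > 0`, `f` has continuous partial derivatives up to order `ν` on
`f⁻¹([c - 2δ₀, c + 2δ₀])`, where its gradient has norm larger than `ε₀`. -/
def DensitySmoothness {d : ℕ} (f : Eucl d → ℝ) (c : ℝ) (ν : ℕ) : Prop :=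
  ∃ δ₀ > 0, ∃ ε₀ > 0, ∀ x ∈ levelBand f c (2 * δ₀),
    ContDiffAt ℝ (ν : WithTop ℕ∞) f x ∧ ε₀ < ‖gradient f x‖

/-- The normalized gradient. -/
def unitNormal {d : ℕ} (f : Eucl d → ℝ) (x : Eucl d) : Eucl d :=
  ‖gradient f x‖⁻¹ • gradient f x

/-- The tangent space at `x` (a linear subspace of `ℝ^d`) of the level set of `f` through `x`. -/
def tangentSpace {d : ℕ} (f : Eucl d → ℝ) (x : Eucl d) : Submodule ℝ (Eucl d) :=
  (ℝ ∙ gradient f x)ᗮ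

/-- The affine plane `{y + t N(x) : y ∈ T_x}`. -/
def tangentPlane {d : ℕ} (f : Eucl d → ℝ) (x : Eucl d) (t : ℝ) : Set (Eucl d) :=
  (fun y => y + t • unitNormal f x) '' (tangentSpace f x : Set (Eucl d))

/-- `R_K(x) = ∫ (∫_{T_{x,t}} K dℋ)² dt`. -/
def roughness {d : ℕ} (f K : Eucl d → ℝ) (x : Eucl d) : ℝ :=
  ∫ t : ℝ, (∫ u in tangentPlane f x t, K u ∂μHE[d - 1]) ^ 2

/-- The kernel density estimator at `x`, with bandwidth `h`, from the sample `X 0, …, X (n-1)`. -/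
def kde {d : ℕ} {Ω : Type*} (K : Eucl d → ℝ) (X : ℕ → Ω → Eucl d) (n : ℕ) (h : ℝ)
    (x : Eucl d) (ω : Ω) : ℝ :=
  1 / (n * h ^ d) * ∑ i ∈ Finset.range n, K (h⁻¹ • (x - X i ω))

end LevelSetKDE

end

noncomputable section

namespace LevelSetKDE

/-! Write `G_h(y) = ∫_M w(x) K((x - y)/h) dℋ(x)` for the surface measure smoothed at scale `h`
(`smoothedSurface`), with `m = d - 1`. Exchanging the finite sum with the surface integral turns the
statistic, exactly, into a sum of i.i.d. centred terms `√(nh)/(n h^d) · (G_h(X_i) - E G_h(X_i))`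
(`sqrt_mul_setIntegral_kde_sub`). A ball of radius of order `h` carries surface mass `O(h^m)`, so
`G_h = O(h^m)` uniformly and each term is `O((nh)^(-1/2))`. Hence a characteristic function argument
for uniformly small summands suffices (`tendstoInDistribution_sum_of_bounded`), and only the
variance is left to compute.

The total variance is `h^(-m-d) (E G_h² - (E G_h)²)`. The mean is `O(h^d)`, so its square
contributes `O(h)`. By Fubini, `E G_h²` is a double surface integral of `w(x) w(a)` against the
`f`-mean of the product of two kernels. As `f` is close to `c` near `M`, that mean is approximately
`c h^d Φ((a - x)/h)`, where `Φ` is the autocorrelation of `K`. Seen from `x` at scale `h`, the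
surface flattens to its tangent plane (`tendsto_blowup`), so the inner integral tends to `c w(x)
∫_{T_x} Φ`. Dominated convergence gives the limit, and slicing space by hyperplanes parallel to
`T_x` identifies `∫_{T_x} Φ` with `R_K(x)` (`roughness_eq_integral_autocorrelation`).

The blow-up uses neither charts nor an area formula. Near `x` the orthogonal projection to `T_x` is
1-Lipschitz on `M` with inverse `(1 - ε)⁻¹`-Lipschitz, so it distorts `m`-dimensional measure by a
factor at most `(1 - ε)^(-m)`. -/

/-! ### Central limit theorem for small bounded summands. -/

/-- Second order Taylor expansion of the characteristic function of a bounded centred variable. -/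
lemma norm_integral_cexp_sub_le {E : Type*} [MeasurableSpace E] {μ : Measure E}
    [IsProbabilityMeasure μ] {g : E → ℝ} (hg : Measurable g) {a : ℝ} (hga : ∀ y, |g y| ≤ a)
    (hg0 : ∫ y, g y ∂μ = 0) {t : ℝ} (ht : |t| * a ≤ 1) :
    ‖∫ y, Complex.exp (t * g y * Complex.I) ∂μ - 1 + ((t ^ 2 / 2 * ∫ y, g y ^ 2 ∂μ : ℝ) : ℂ)‖
      ≤ |t| ^ 3 * a * ∫ y, g y ^ 2 ∂μ := by
  have hgi : Integrable g μ :=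
    Integrable.of_bound hg.aestronglyMeasurable a (ae_of_all _ fun y => by simpa using hga y)
  have hg2 : Integrable (fun y => g y ^ 2) μ :=
    Integrable.of_bound (hg.pow_const 2).aestronglyMeasurable (a ^ 2)
      (ae_of_all _ fun y => by
        rw [Real.norm_eq_abs, abs_pow]; exact pow_le_pow_left₀ (abs_nonneg _) (hga y) 2)
  have hei : Integrable (fun y => Complex.exp (t * g y * Complex.I)) μ :=
    Integrable.of_bound (by fun_prop) 1 (ae_of_all _ fun y => by
      rw [← Complex.ofReal_mul, Complex.norm_exp_ofReal_mul_I])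
  have hpt : ∀ y, ‖Complex.exp (t * g y * Complex.I) - 1 - ((t * g y : ℝ) : ℂ) * Complex.I
      + ((t ^ 2 / 2 * g y ^ 2 : ℝ) : ℂ)‖ ≤ |t| ^ 3 * a * g y ^ 2 := by
    intro y
    have hx : ‖((t * g y : ℝ) : ℂ) * Complex.I‖ = |t| * |g y| := by
      simp
    have hx1 : ‖((t * g y : ℝ) : ℂ) * Complex.I‖ ≤ 1 :=
      hx ▸ (mul_le_mul_of_nonneg_left (hga y) (abs_nonneg t)).trans ht
    -- The cubic remainder bound is valid for arguments of norm at most 1, which is what `|t| * a ≤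
    -- 1` ensures. Its constant is `4/18`, below 1.
    have hb := Complex.exp_bound hx1 (n := 3) (by norm_num)
    rw [hx] at hb
    have h1 : (Finset.range 3).sum
        (fun m => (((t * g y : ℝ) : ℂ) * Complex.I) ^ m / (m.factorial : ℂ))
        = 1 + ((t * g y : ℝ) : ℂ) * Complex.I - ((t ^ 2 / 2 * g y ^ 2 : ℝ) : ℂ) := by
      simp only [Finset.sum_range_succ, Finset.sum_range_zero, mul_pow, Complex.I_sq]
      push_cast
      simp [Nat.factorial]
      ring
    rw [h1] at hb
    have h2 : Complex.exp (t * g y * Complex.I) - 1 - ((t * g y : ℝ) : ℂ) * Complex.I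
        + ((t ^ 2 / 2 * g y ^ 2 : ℝ) : ℂ) = Complex.exp (((t * g y : ℝ) : ℂ) * Complex.I)
        - (1 + ((t * g y : ℝ) : ℂ) * Complex.I - ((t ^ 2 / 2 * g y ^ 2 : ℝ) : ℂ)) := by
      push_cast; ring
    rw [h2]
    refine hb.trans ?_
    have h3 : (|t| * |g y|) ^ 3 ≤ |t| ^ 3 * a * g y ^ 2 := by
      have : (|t| * |g y|) ^ 3 = |t| ^ 3 * |g y| * g y ^ 2 := by
        rw [← sq_abs (g y)]; ring
      rw [this]
      have := hga y
      gcongr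
    refine le_trans ?_ h3
    have : (0 : ℝ) ≤ (|t| * |g y|) ^ 3 := by positivity
    norm_num [Nat.factorial]
    linarith
  have hexpand : ∫ y, (Complex.exp (t * g y * Complex.I) - 1 - ((t * g y : ℝ) : ℂ) * Complex.I
      + ((t ^ 2 / 2 * g y ^ 2 : ℝ) : ℂ)) ∂μ
      = ∫ y, Complex.exp (t * g y * Complex.I) ∂μ - 1
        + ((t ^ 2 / 2 * ∫ y, g y ^ 2 ∂μ : ℝ) : ℂ) := by
    have i1 : Integrable (fun y => ((t * g y : ℝ) : ℂ) * Complex.I) μ :=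
      (hgi.const_mul t).ofReal.mul_const _
    have i2 : Integrable (fun y => ((t ^ 2 / 2 * g y ^ 2 : ℝ) : ℂ)) μ :=
      (hg2.const_mul _).ofReal
    have i3 : Integrable (fun y => Complex.exp (t * g y * Complex.I) - 1) μ :=
      hei.sub (integrable_const (1 : ℂ))
    have i4 : Integrable (fun y => Complex.exp (t * g y * Complex.I) - 1
        - ((t * g y : ℝ) : ℂ) * Complex.I) μ := i3.sub i1
    rw [integral_add i4 i2, integral_sub i3 i1, integral_sub hei (integrable_const _),
      integral_mul_const, integral_complex_ofReal, integral_const_mul, hg0, integral_complex_ofReal,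
      integral_const_mul]
    simp
  rw [← hexpand, ← integral_const_mul]
  exact norm_integral_le_of_norm_le (hg2.const_mul _) (ae_of_all _ hpt)

/-- A central limit theorem for row sums `∑ i < n, g n (X i)` of uniformly small bounded centred
functions of an i.i.d. sequence. -/
theorem tendstoInDistribution_sum_of_bounded {Ω E : Type*} [MeasurableSpace Ω]
    [MeasurableSpace E] {P : Measure Ω} [IsProbabilityMeasure P] {μ : Measure E}
    [IsProbabilityMeasure μ] {X : ℕ → Ω → E} (hX : iIndepFun X P) (hlaw : ∀ i, HasLaw (X i) μ P)
    {g : ℕ → E → ℝ} (hg : ∀ n, Measurable (g n)) (hg0 : ∀ n, ∫ y, g n y ∂μ = 0)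
    {a : ℕ → ℝ} (ha : Tendsto a atTop (𝓝 0)) (hga : ∀ᶠ n in atTop, ∀ y, |g n y| ≤ a n)
    {v : ℝ} (hv : 0 ≤ v) (hvar : Tendsto (fun n : ℕ => n * ∫ y, g n y ^ 2 ∂μ) atTop (𝓝 v)) :
    TendstoInDistribution (fun (n : ℕ) ω => ∑ i ∈ Finset.range n, g n (X i ω)) atTop id
      (fun _ => P) (gaussianReal 0 v.toNNReal) where
  forall_aemeasurable n := Finset.aemeasurable_fun_sum _ fun i _ =>
    (hg n).comp_aemeasurable (hlaw i).aemeasurable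
  tendsto := by
    refine ProbabilityMeasure.tendsto_iff_tendsto_charFun.2 fun t => ?_
    -- Independence and the common law make the characteristic function an `n`-th power, written as
    -- `(1 + z_n) ^ n` so that the limit of `n z_n` decides it.
    have hchar : ∀ n : ℕ, charFun (P.map fun ω => ∑ i ∈ Finset.range n, g n (X i ω)) t
        = (1 + (∫ y, Complex.exp (t * g n y * Complex.I) ∂μ - 1)) ^ n := by
      intro n
      have hm : ∀ i, AEMeasurable (fun ω => g n (X i ω)) P := fun i =>
        (hg n).comp_aemeasurable (hlaw i).aemeasurable
      have hind : iIndepFun (fun i ω => g n (X i ω)) P := hX.comp _ fun _ => hg n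
      rw [iIndepFun.charFun_map_fun_finsetSum_eq_prod (fun i _ => hm i) (hind.restrict _),
        Finset.prod_apply]
      have : ∀ i ∈ Finset.range n, charFun (P.map fun ω => g n (X i ω)) t
          = 1 + (∫ y, Complex.exp (t * g n y * Complex.I) ∂μ - 1) := by
        intro i _
        rw [charFun_apply_real, integral_map (hm i) (by fun_prop), ← (hlaw i).map_eq,
          integral_map (hlaw i).aemeasurable (by have := hg n; fun_prop)]
        ring
      rw [Finset.prod_congr rfl this]
      simp
    have hlim : Tendsto (fun n : ℕ =>
        (n : ℂ) * (∫ y, Complex.exp (t * g n y * Complex.I) ∂μ - 1)) atTop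
        (𝓝 (((-(t ^ 2 / 2 * v) : ℝ)) : ℂ)) := by
      have hmain : Tendsto (fun n : ℕ => ((-(t ^ 2 / 2 * (n * ∫ y, g n y ^ 2 ∂μ)) : ℝ) : ℂ))
          atTop (𝓝 (((-(t ^ 2 / 2 * v) : ℝ)) : ℂ)) :=
        (Complex.continuous_ofReal.tendsto _).comp (hvar.const_mul _).neg
      have herr : Tendsto (fun n : ℕ => (n : ℂ) *
          (∫ y, Complex.exp (t * g n y * Complex.I) ∂μ - 1
            + ((t ^ 2 / 2 * ∫ y, g n y ^ 2 ∂μ : ℝ) : ℂ))) atTop (𝓝 0) := by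
        -- The Taylor error keeps one factor `a n → 0` beside `n ∫ g²`, which stays bounded because
        -- it converges.
        have hb : Tendsto (fun n : ℕ => |t| ^ 3 * a n * (n * ∫ y, g n y ^ 2 ∂μ)) atTop (𝓝 0) := by
          simpa using (ha.const_mul (|t| ^ 3)).mul hvar
        refine squeeze_zero_norm' ?_ hb
        have hta : ∀ᶠ n in atTop, |t| * a n ≤ 1 := by
          have := ha.const_mul |t|
          rw [mul_zero] at this
          exact this.eventually_le_const one_pos
        filter_upwards [hga, hta] with n hn htn
        rw [norm_mul, Complex.norm_natCast]
        calc (n : ℝ) * _ ≤ n * (|t| ^ 3 * a n * ∫ y, g n y ^ 2 ∂μ) :=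
              mul_le_mul_of_nonneg_left (norm_integral_cexp_sub_le (hg n) hn (hg0 n) htn)
                n.cast_nonneg
          _ = _ := by ring
      have := hmain.add herr
      rw [add_zero] at this
      refine this.congr fun n => ?_
      push_cast
      ring
    have hexp := Complex.tendsto_one_add_pow_exp_of_tendsto hlim
    have hlimit : charFun ((gaussianReal 0 v.toNNReal).map id) t
        = Complex.exp ((-(t ^ 2 / 2 * v) : ℝ) : ℂ) := by
      rw [Measure.map_id, charFun_gaussianReal, Real.coe_toNNReal v hv]
      congr 1
      push_cast
      ring
    simp only [ProbabilityMeasure.coe_mk]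
    rw [hlimit]
    exact hexp.congr fun n => (hchar n).symm

/-! ### Tangent planes of sets -/

/-- `T` is a tangent plane of `S` at `x`: near `x` the chords of `S` are nearly parallel to `T`, and
the orthogonal projection of `S - x` to `T` covers a neighbourhood of the origin. -/
def IsTangentAt {d : ℕ} (S : Set (Eucl d)) (T : Submodule ℝ (Eucl d)) (x : Eucl d) : Prop :=
  ∀ ε > 0, ∃ r > 0,
    (∀ a ∈ S ∩ Metric.ball x r, ∀ b ∈ S ∩ Metric.ball x r,
      ‖(a - b) - T.orthogonalProjectionOnto (a - b)‖ ≤ ε * ‖a - b‖) ∧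
    ∃ r' > 0, ∀ z : T, ‖z‖ < r' → ∃ a ∈ S ∩ Metric.ball x r, T.orthogonalProjectionOnto (a - x) = z

/-- Strict differentiability controls both endpoints of a chord at once, and `f` has no increment
along a chord of its level set, so the normal component of the chord is small. For the covering, the
map `a ↦ (p (a - x), f a)` has a surjective strict derivative and is therefore open at `x`. Points
of its image with second coordinate `f x` come from the level set. -/
lemma isTangentAt_levelSet {d : ℕ} {f : Eucl d → ℝ} {g x : Eucl d} (hg : g ≠ 0)
    (hf : HasStrictFDerivAt f (InnerProductSpace.toDual ℝ (Eucl d) g) x) :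
    IsTangentAt (levelSet f (f x)) (ℝ ∙ g)ᗮ x := by
  intro ε hε
  have hgn : 0 < ‖g‖ := norm_pos_iff.2 hg
  set T : Submodule ℝ (Eucl d) := (ℝ ∙ g)ᗮ
  set p : Eucl d →L[ℝ] T := T.orthogonalProjectionOnto
  have hproj : ∀ u : Eucl d, u - p u = (inner ℝ g u / ‖g‖ ^ 2) • g := by
    intro u
    have h := Submodule.starProjection_singleton ℝ (v := g) u
    have h2 := Submodule.starProjection_orthogonal_val (K := ℝ ∙ g) u
    rw [h] at h2
    have h3 : (p u : Eucl d) = u - (inner ℝ g u / ((‖g‖ ^ 2 : ℝ) : ℝ)) • g := by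
      rw [← Submodule.starProjection_apply] at *
      exact h2
    rw [h3]; simp
  -- The tolerance is `ε ‖g‖` because the normal component of a chord has length `|⟨g, a - b⟩| /
  -- ‖g‖`.
  have hsmall := hf.isLittleO.def (mul_pos hε hgn)
  rw [nhds_prod_eq, (Metric.nhds_basis_ball.prod_self).eventually_iff] at hsmall
  obtain ⟨r, hr, hsmall⟩ := hsmall
  refine ⟨r, hr, ?_, ?_⟩
  · rintro a ⟨ha, har⟩ b ⟨hb, hbr⟩
    have h := hsmall (x := (a, b)) ⟨har, hbr⟩
    simp only [levelSet, Set.mem_preimage, Set.mem_singleton_iff] at ha hb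
    simp only [ha, hb, sub_self, zero_sub, norm_neg, InnerProductSpace.toDual_apply_apply] at h
    rw [hproj, norm_smul, norm_div, norm_pow, norm_norm]
    calc ‖inner ℝ g (a - b)‖ / ‖g‖ ^ 2 * ‖g‖ = ‖inner ℝ g (a - b)‖ / ‖g‖ := by field_simp
      _ ≤ ε * ‖g‖ * ‖a - b‖ / ‖g‖ := by gcongr
      _ = ε * ‖a - b‖ := by field_simp
  · have hd : HasStrictFDerivAt (fun a => (p (a - x), f a))
        (p.prod (InnerProductSpace.toDual ℝ (Eucl d) g)) x := by
      refine HasStrictFDerivAt.prodMk ?_ hf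
      simpa using p.hasStrictFDerivAt.comp x ((hasStrictFDerivAt_id x).sub_const x)
    have hsurj : (p.prod (InnerProductSpace.toDual ℝ (Eucl d) g)).range = ⊤ := by
      rw [LinearMap.range_eq_top]
      rintro ⟨z, s⟩
      refine ⟨z + (s / ‖g‖ ^ 2) • g, ?_⟩
      have hpg : p g = 0 := by
        have := hproj g
        rw [real_inner_self_eq_norm_sq, div_self (by positivity), one_smul] at this
        simpa using this
      have hgz : inner ℝ g (z : Eucl d) = 0 :=
        Submodule.mem_orthogonal_singleton_iff_inner_right.1 z.2
      have hpz : p (z : Eucl d) = z := Submodule.orthogonalProjectionOnto_mem_subspace_eq_self z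
      refine Prod.ext ?_ ?_
      · change p (z + (s / ‖g‖ ^ 2) • g) = z
        rw [map_add, map_smul, hpg, hpz]; simp
      · change inner ℝ g (z + (s / ‖g‖ ^ 2) • g) = s
        rw [inner_add_right, inner_smul_right, hgz, real_inner_self_eq_norm_sq]
        field_simp
        simp
    have hmap := hd.map_nhds_eq_of_surj hsurj
    have hmem : (fun a => (p (a - x), f a)) '' Metric.ball x r ∈ 𝓝 ((0 : T), f x) := by
      have := image_mem_map (m := fun a => (p (a - x), f a)) (Metric.ball_mem_nhds x hr)
      rw [hmap] at this
      simpa using this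
    obtain ⟨r', hr', hsub⟩ := Metric.mem_nhds_iff.1 hmem
    refine ⟨r', hr', fun z hz => ?_⟩
    obtain ⟨a, har, ha⟩ := hsub (show (z, f x) ∈ Metric.ball ((0 : T), f x) r' by
      simpa [Prod.dist_eq, dist_zero_right, hr'] using hz)
    simp only [Prod.mk.injEq] at ha
    exact ⟨a, ⟨ha.2, har⟩, ha.1⟩

/-! ### Hausdorff measure of sets with small slope -/

lemma euclideanHausdorffMeasure_image_le {X Y : Type*} [EMetricSpace X] [MeasurableSpace X]
    [BorelSpace X] [EMetricSpace Y] [MeasurableSpace Y] [BorelSpace Y] {C : NNReal} {g : X → Y}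
    {s : Set X} (hg : LipschitzOnWith C g s) (m : ℕ) :
    μHE[m] (g '' s) ≤ (C : ENNReal) ^ m * μHE[m] s := by
  rw [Measure.euclideanHausdorffMeasure_def, Measure.euclideanHausdorffMeasure_def,
    Measure.smul_apply, Measure.smul_apply, ← ENNReal.rpow_natCast, ENNReal.smul_def,
    ENNReal.smul_def, smul_eq_mul, smul_eq_mul, mul_left_comm]
  gcongr
  exact hg.hausdorffMeasure_image_le m.cast_nonneg

lemma le_euclideanHausdorffMeasure_image {X Y : Type*} [EMetricSpace X] [MeasurableSpace X]
    [BorelSpace X] [EMetricSpace Y] [MeasurableSpace Y] [BorelSpace Y] {C : NNReal} {g : X → Y}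
    (hg : AntilipschitzWith C g) (m : ℕ) (s : Set X) :
    μHE[m] s ≤ (C : ENNReal) ^ m * μHE[m] (g '' s) := by
  rw [Measure.euclideanHausdorffMeasure_def, Measure.euclideanHausdorffMeasure_def,
    Measure.smul_apply, Measure.smul_apply, ← ENNReal.rpow_natCast, ENNReal.smul_def,
    ENNReal.smul_def, smul_eq_mul, smul_eq_mul, mul_left_comm]
  gcongr
  exact hg.le_hausdorffMeasure_image m.cast_nonneg s

section Projection

variable {d m : ℕ} {T : Submodule ℝ (Eucl d)} {N : Set (Eucl d)} {x : Eucl d} {ε : ℝ}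

lemma norm_le_of_norm_sub_orthogonalProjectionOnto_le {u : Eucl d} (hε1 : ε < 1)
    (h : ‖u - T.orthogonalProjectionOnto u‖ ≤ ε * ‖u‖) :
    ‖u‖ ≤ (1 - ε)⁻¹ * ‖T.orthogonalProjectionOnto u‖ := by
  have h1 : ‖u‖ ≤ ‖u - T.orthogonalProjectionOnto u‖ + ‖T.orthogonalProjectionOnto u‖ := by
    simpa using norm_add_le (u - T.orthogonalProjectionOnto u)
      (T.orthogonalProjectionOnto u : Eucl d)
  rw [inv_mul_eq_div, le_div_iff₀ (by linarith)]
  nlinarith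

/-- The projection is 1-Lipschitz, and on an `m`-dimensional inner product space the normalized
Hausdorff measure is Lebesgue measure. -/
lemma volume_image_orthogonalProjectionOnto_le (hT : Module.finrank ℝ T = m)
    (A : Set (Eucl d)) (x : Eucl d) :
    volume ((fun a => T.orthogonalProjectionOnto (a - x)) '' A) ≤ μHE[m] A := by
  have hlip : LipschitzOnWith 1 (fun a => T.orthogonalProjectionOnto (a - x)) A := by
    refine LipschitzOnWith.of_dist_le_mul fun a _ b _ => ?_
    rw [dist_eq_norm, ← map_sub, NNReal.coe_one, one_mul, dist_eq_norm, sub_sub_sub_cancel_right]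
    exact T.norm_orthogonalProjectionOnto_apply_le _
  have := euclideanHausdorffMeasure_image_le hlip m
  subst hT
  rw [InnerProductSpace.euclideanHausdorffMeasure_eq_volume] at this
  simpa using this

/-- Chords of small slope are shortened by the projection by a factor at least `1 - ε`, so its
inverse on the image is `(1 - ε)⁻¹`-Lipschitz. -/
lemma euclideanHausdorffMeasure_le_volume_image (hT : Module.finrank ℝ T = m) (hε1 : ε < 1)
    (hN : ∀ a ∈ N, ∀ b ∈ N, ‖(a - b) - T.orthogonalProjectionOnto (a - b)‖ ≤ ε * ‖a - b‖)
    (x : Eucl d) :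
    μHE[m] N ≤ ENNReal.ofReal ((1 - ε)⁻¹ ^ m) *
      volume ((fun a => T.orthogonalProjectionOnto (a - x)) '' N) := by
  have hanti : AntilipschitzWith (1 - ε)⁻¹.toNNReal
      (fun a : N => T.orthogonalProjectionOnto ((a : Eucl d) - x)) := by
    refine AntilipschitzWith.of_le_mul_dist fun a b => ?_
    rw [Real.coe_toNNReal _ (inv_nonneg.2 (by linarith)), dist_eq_norm
      (T.orthogonalProjectionOnto _), ← map_sub,
      sub_sub_sub_cancel_right, Subtype.dist_eq, dist_eq_norm]
    exact norm_le_of_norm_sub_orthogonalProjectionOnto_le hε1 (hN a a.2 b b.2)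
  have h := le_euclideanHausdorffMeasure_image hanti m Set.univ
  rw [← (isometry_subtype_coe (s := N)).euclideanHausdorffMeasure_image, Set.image_univ,
    Subtype.range_coe, Set.image_univ] at h
  subst hT
  rw [InnerProductSpace.euclideanHausdorffMeasure_eq_volume] at h
  rw [ENNReal.ofReal_pow (inv_nonneg.2 (by linarith)), Set.image_eq_range]
  exact h

/-- The projection of the Hausdorff measure of a set with small slope is at most a constant times
Lebesgue measure. -/
lemma map_orthogonalProjectionOnto_le (hT : Module.finrank ℝ T = m) (hε1 : ε < 1)
    (hN : ∀ a ∈ N, ∀ b ∈ N, ‖(a - b) - T.orthogonalProjectionOnto (a - b)‖ ≤ ε * ‖a - b‖)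
    (x : Eucl d) :
    ((μHE[m] : Measure (Eucl d)).restrict N).map (fun a => T.orthogonalProjectionOnto (a - x))
      ≤ ENNReal.ofReal ((1 - ε)⁻¹ ^ m) • volume := by
  have hmeas : Measurable (fun a => T.orthogonalProjectionOnto (a - x)) := by fun_prop
  refine Measure.le_iff.2 fun A hA => ?_
  rw [Measure.map_apply hmeas hA, Measure.restrict_apply (hmeas hA), Measure.smul_apply,
    smul_eq_mul]
  refine (euclideanHausdorffMeasure_le_volume_image hT hε1
    (fun a ha b hb => hN a ha.2 b hb.2) x).trans ?_
  gcongr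
  rintro _ ⟨a, ha, rfl⟩
  exact ha.1

/-- The projection of the Hausdorff measure of a set is at least Lebesgue measure on the part of
the plane that is covered. -/
lemma restrict_le_map_orthogonalProjectionOnto (hT : Module.finrank ℝ T = m) {B : Set T}
    (hB : B ⊆ (fun a => T.orthogonalProjectionOnto (a - x)) '' N) :
    volume.restrict B ≤ ((μHE[m] : Measure (Eucl d)).restrict N).map
      (fun a => T.orthogonalProjectionOnto (a - x)) := by
  have hmeas : Measurable (fun a => T.orthogonalProjectionOnto (a - x)) := by fun_prop
  refine Measure.le_iff.2 fun A hA => ?_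
  rw [Measure.map_apply hmeas hA, Measure.restrict_apply (hmeas hA), Measure.restrict_apply hA]
  refine le_trans (measure_mono ?_) (volume_image_orthogonalProjectionOnto_le hT _ x)
  rintro z ⟨hzA, hzB⟩
  obtain ⟨a, ha, rfl⟩ := hB hzB
  exact ⟨a, ⟨hzA, ha⟩, rfl⟩

end Projection

/-- A compact set with tangent planes of dimension `m` is upper Ahlfors regular. -/
lemma exists_measure_inter_ball_le {d m : ℕ} {S : Set (Eucl d)} (hS : IsCompact S)
    (hT : ∀ x ∈ S, ∃ T : Submodule ℝ (Eucl d), Module.finrank ℝ T = m ∧ IsTangentAt S T x) :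
    ∃ C > 0, ∃ r₀ > 0, ∀ x ∈ S, ∀ r > 0, r ≤ r₀ →
      μHE[m] (S ∩ Metric.ball x r) ≤ ENNReal.ofReal (C * r ^ m) := by
  -- The property used for compactness induction restricts only the centre to `S ∩ U`. The measured
  -- set stays inside the whole of `S`.
  suffices H : ∃ C > 0, ∃ r₀ > 0, ∀ x ∈ S ∩ S, ∀ r > 0, r ≤ r₀ →
      μHE[m] (S ∩ Metric.ball x r) ≤ ENNReal.ofReal (C * r ^ m) by simpa using H
  refine hS.induction_on (p := fun U => ∃ C > 0, ∃ r₀ > 0, ∀ x ∈ S ∩ U, ∀ r > 0, r ≤ r₀ →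
      μHE[m] (S ∩ Metric.ball x r) ≤ ENNReal.ofReal (C * r ^ m)) ?_ ?_ ?_ ?_
  · exact ⟨1, one_pos, 1, one_pos, by simp⟩
  · rintro U V hUV ⟨C, hC, r₀, hr₀, h⟩
    exact ⟨C, hC, r₀, hr₀, fun x hx => h x ⟨hx.1, hUV hx.2⟩⟩
  · rintro U V ⟨C, hC, r₀, hr₀, h⟩ ⟨C', hC', r₀', hr₀', h'⟩
    refine ⟨max C C', lt_max_of_lt_left hC, min r₀ r₀', lt_min hr₀ hr₀', ?_⟩
    rintro x ⟨hxS, hx | hx⟩ r hr hrr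
    · refine (h x ⟨hxS, hx⟩ r hr (hrr.trans (min_le_left _ _))).trans ?_
      gcongr
      exact le_max_left _ _
    · refine (h' x ⟨hxS, hx⟩ r hr (hrr.trans (min_le_right _ _))).trans ?_
      gcongr
      exact le_max_right _ _
  · intro x hx
    obtain ⟨T, hTm, hTx⟩ := hT x hx
    obtain ⟨r, hr, hchord, -⟩ := hTx (1 / 2) (by norm_num)
    -- With centres within `r / 2` of `x` and radii at most `r / 2`, every ball stays in `ball x r`,
    -- where the slope is at most `1 / 2`. The factor `2 ^ m` is `(1 - 1/2)⁻¹ ^ m`, and the added 1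
    -- makes the constant positive.
    refine ⟨Metric.ball x (r / 2), mem_nhdsWithin_of_mem_nhds (Metric.ball_mem_nhds x (half_pos hr)),
      2 ^ m * (volume (Metric.ball (0 : T) 1)).toReal + 1, by positivity, r / 2, half_pos hr, ?_⟩
    rintro y ⟨hyS, hy⟩ s hs hsr
    have hsub : S ∩ Metric.ball y s ⊆ S ∩ Metric.ball x r := by
      refine Set.inter_subset_inter_right _ (Metric.ball_subset_ball' ?_)
      rw [Metric.mem_ball] at hy
      linarith
    have hb : (fun a => T.orthogonalProjectionOnto (a - y)) '' (S ∩ Metric.ball y s)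
        ⊆ Metric.ball 0 s := by
      rintro _ ⟨a, ha, rfl⟩
      rw [mem_ball_zero_iff]
      refine (T.norm_orthogonalProjectionOnto_apply_le _).trans_lt ?_
      rw [← dist_eq_norm]; exact ha.2
    refine (euclideanHausdorffMeasure_le_volume_image hTm (by norm_num : (1 / 2 : ℝ) < 1)
      (fun a ha b hb => hchord a (hsub ha) b (hsub hb)) y).trans ?_
    refine (mul_le_mul_right (measure_mono hb) _).trans ?_
    rw [Measure.addHaar_ball_of_pos volume _ hs, hTm,
      ← ENNReal.ofReal_toReal (measure_ball_lt_top (μ := volume) (x := (0 : T)) (r := 1)).ne,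
      ← ENNReal.ofReal_mul (by positivity), ← ENNReal.ofReal_mul (by positivity)]
    refine ENNReal.ofReal_le_ofReal ?_
    rw [ENNReal.toReal_ofReal ENNReal.toReal_nonneg]
    have : (0 : ℝ) ≤ s ^ m := by positivity
    norm_num
    nlinarith

lemma measure_lt_top_of_isTangentAt {d m : ℕ} {S : Set (Eucl d)} (hS : IsCompact S)
    (hT : ∀ x ∈ S, ∃ T : Submodule ℝ (Eucl d), Module.finrank ℝ T = m ∧ IsTangentAt S T x) :
    μHE[m] S < ⊤ := by
  obtain ⟨C, -, r₀, hr₀, h⟩ := exists_measure_inter_ball_le hS hT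
  refine hS.measure_lt_top_of_nhdsWithin fun x hx => ⟨S ∩ Metric.ball x r₀, ?_, ?_⟩
  · exact inter_mem_nhdsWithin S (Metric.ball_mem_nhds x hr₀)
  · exact (h x hx r₀ hr₀ le_rfl).trans_lt ENNReal.ofReal_lt_top

/-! ### Blow-up of the Hausdorff measure at a point -/

/-- The lower bound on `τ` is applied to the nonnegative functions `|ψ| ± ψ`, both carried by `B`,
and the upper bound to `|ψ|`. Combining them bounds both signs of the difference. -/
lemma abs_integral_sub_le_of_measure_le {E : Type*} [MeasurableSpace E] {μ τ : Measure E}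
    {B : Set E} {c : ℝ} (hc : 0 ≤ c) (hl : μ.restrict B ≤ τ) (hu : τ ≤ ENNReal.ofReal c • μ)
    {ψ : E → ℝ} (hψ : Integrable ψ μ) (hB : ∀ z, z ∉ B → ψ z = 0) :
    |∫ z, ψ z ∂τ - ∫ z, ψ z ∂μ| ≤ (c - 1) * ∫ z, |ψ z| ∂μ := by
  have hcτ : ∀ {u : E → ℝ}, Integrable u μ → Integrable u τ := fun hu' =>
    (hu'.smul_measure ENNReal.ofReal_ne_top).mono_measure hu
  have hlow : ∀ {u : E → ℝ}, Integrable u μ → (∀ z, 0 ≤ u z) → (∀ z, z ∉ B → u z = 0) →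
      ∫ z, u z ∂μ ≤ ∫ z, u z ∂τ := by
    intro u hui hu0 huB
    rw [← setIntegral_eq_integral_of_forall_compl_eq_zero huB]
    exact integral_mono_measure hl (ae_of_all _ hu0) (hcτ hui)
  have hupp : ∫ z, |ψ z| ∂τ ≤ c * ∫ z, |ψ z| ∂μ := by
    refine (integral_mono_measure hu (ae_of_all _ fun z => abs_nonneg _)
      (hψ.abs.smul_measure ENNReal.ofReal_ne_top)).trans_eq ?_
    rw [integral_smul_measure, ENNReal.toReal_ofReal hc, smul_eq_mul]
  have h1 := hlow (hψ.abs.add hψ) (fun z => by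
    have := neg_abs_le (ψ z); simp only [Pi.add_apply]; linarith) (fun z hz => by simp [hB z hz])
  have h2 := hlow (hψ.abs.sub hψ) (fun z => by
    have := le_abs_self (ψ z); simp only [Pi.sub_apply]; linarith) (fun z hz => by simp [hB z hz])
  rw [integral_add' hψ.abs hψ, integral_add' (hcτ hψ.abs) (hcτ hψ)] at h1
  rw [integral_sub' hψ.abs hψ, integral_sub' (hcτ hψ.abs) (hcτ hψ)] at h2
  rw [abs_le]
  constructor <;> linarith

lemma exists_pos_radius {d : ℕ} {φ : Eucl d → ℝ} (hφ : HasCompactSupport φ) :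
    ∃ R > 0, ∀ z, R ≤ ‖z‖ → φ z = 0 := by
  obtain ⟨R, hR⟩ := hφ.isBounded.subset_closedBall (0 : Eucl d)
  refine ⟨max R 0 + 1, by positivity, fun z hz => ?_⟩
  by_contra hne
  have := hR (subset_tsupport φ hne)
  rw [mem_closedBall_zero_iff] at this
  linarith [le_max_left R 0]

/-- Comparison at a fixed scale `h` between the Hausdorff measure on a set with small slope and
Lebesgue measure on its tangent plane. -/
lemma abs_setIntegral_sub_integral_tangent_le {d m : ℕ} {S : Set (Eucl d)} (hS : MeasurableSet S)
    (hfin : μHE[m] S < ⊤) {T : Submodule ℝ (Eucl d)} (hT : Module.finrank ℝ T = m)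
    {x : Eucl d} (hx : x ∈ S) {φ : Eucl d → ℝ} (hφ : Continuous φ) (hφc : HasCompactSupport φ)
    {R : ℝ} (hφR : ∀ z, R ≤ ‖z‖ → φ z = 0) {ε r r' : ℝ} (hε : 0 < ε) (hε2 : ε ≤ 1 / 2)
    (hchord : ∀ a ∈ S ∩ Metric.ball x r, ∀ b ∈ S ∩ Metric.ball x r,
      ‖(a - b) - T.orthogonalProjectionOnto (a - b)‖ ≤ ε * ‖a - b‖)
    (hcover : ∀ z : T, ‖z‖ < r' → ∃ a ∈ S ∩ Metric.ball x r,
      T.orthogonalProjectionOnto (a - x) = z)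
    {η : ℝ} (hη : ∀ u v, ‖u - v‖ ≤ ε * (2 * R) → |φ u - φ v| ≤ η) (hη0 : 0 ≤ η)
    {h : ℝ} (hh : 0 < h) (hR : 0 < R) (hr : h * R < r) (hr' : h * R < r') :
    |(h ^ m)⁻¹ * ∫ a in S, φ (h⁻¹ • (a - x)) ∂μHE[m] - ∫ z : T, φ z| ≤
      η * (2 ^ m * volume.real (Metric.ball (0 : T) (2 * R)))
        + ((1 - ε)⁻¹ ^ m - 1) * ∫ z : T, |φ z| := by
  set N := S ∩ Metric.ball x r with hN
  have hNm : MeasurableSet N := hS.inter measurableSet_ball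
  set p : Eucl d →L[ℝ] T := T.orthogonalProjectionOnto with hp
  set τ := ((μHE[m] : Measure (Eucl d)).restrict N).map (fun a => p (a - x)) with hτ
  have hpm : Measurable (fun a => p (a - x)) := by fun_prop
  have hfinN : μHE[m] N < ⊤ := (measure_mono Set.inter_subset_left).trans_lt hfin
  have : IsFiniteMeasure ((μHE[m] : Measure (Eucl d)).restrict N) :=
    ⟨by rwa [Measure.restrict_apply_univ]⟩
  have hxN : x ∈ N := ⟨hx, Metric.mem_ball_self ((by positivity : 0 < h * R).trans hr)⟩
  have hε1 : ε < 1 := by linarith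
  have hup : τ ≤ ENNReal.ofReal ((1 - ε)⁻¹ ^ m) • volume :=
    map_orthogonalProjectionOnto_le hT hε1 hchord x
  have hlo : volume.restrict (Metric.ball (0 : T) r') ≤ τ := by
    refine restrict_le_map_orthogonalProjectionOnto hT fun z hz => ?_
    obtain ⟨a, ha, haz⟩ := hcover z (mem_ball_zero_iff.1 hz)
    exact ⟨a, ha, haz⟩
  have hconst : (1 - ε)⁻¹ ^ m ≤ 2 ^ m := by
    refine pow_le_pow_left₀ (inv_nonneg.2 (by linarith)) ?_ m
    rw [inv_le_comm₀ (by linarith) two_pos]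
    linarith
  have hnz : ∀ v : Eucl d, φ (h⁻¹ • v) ≠ 0 → ‖v‖ < h * R := by
    intro v hv
    by_contra hcon
    refine hv (hφR _ ?_)
    rw [norm_smul, norm_inv, Real.norm_of_nonneg hh.le, inv_mul_eq_div, le_div_iff₀ hh]
    linarith
  -- reduction to `N`
  have hSN : ∫ a in S, φ (h⁻¹ • (a - x)) ∂μHE[m] = ∫ a in N, φ (h⁻¹ • (a - x)) ∂μHE[m] := by
    refine setIntegral_eq_of_subset_of_forall_sdiff_eq_zero hS Set.inter_subset_left ?_
    rintro a ⟨haS, haN⟩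
    by_contra hne
    have := hnz _ hne
    exact haN ⟨haS, by rw [Metric.mem_ball, dist_eq_norm]; linarith⟩
  -- replacing points by their projections
  obtain ⟨M, hM⟩ := hφc.exists_bound_of_continuous hφ
  have hi1 : Integrable (fun a => φ (h⁻¹ • (a - x))) ((μHE[m] : Measure (Eucl d)).restrict N) :=
    Integrable.of_bound (by fun_prop) M (ae_of_all _ fun a => hM _)
  have hi2 : Integrable (fun a => φ (h⁻¹ • (p (a - x) : Eucl d)))
      ((μHE[m] : Measure (Eucl d)).restrict N) :=
    Integrable.of_bound (by fun_prop) M (ae_of_all _ fun a => hM _)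
  -- The radius is `2 R` because a point whose projection is within `h R` may itself be `2 h R` away
  -- from `x`, as `(1 - ε)⁻¹ ≤ 2`. It also makes the inequalities strict.
  have hball : τ.real (Metric.ball (0 : T) (h * (2 * R)))
      ≤ h ^ m * (2 ^ m * volume.real (Metric.ball (0 : T) (2 * R))) := by
    have h1 : τ (Metric.ball (0 : T) (h * (2 * R))) ≤ ENNReal.ofReal (2 ^ m) *
        (ENNReal.ofReal (h ^ m) * volume (Metric.ball (0 : T) (2 * R))) := by
      refine (hup _).trans ?_
      rw [Measure.smul_apply, smul_eq_mul, Measure.addHaar_ball_mul_of_pos volume _ hh, hT]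
      gcongr
    have h2 := ENNReal.toReal_mono (by finiteness) h1
    rw [ENNReal.toReal_mul, ENNReal.toReal_mul, ENNReal.toReal_ofReal (by positivity),
      ENNReal.toReal_ofReal (by positivity)] at h2
    calc _ ≤ _ := h2
      _ = _ := by rw [measureReal_def]; ring
  have hrepl : |∫ a in N, φ (h⁻¹ • (a - x)) ∂μHE[m] - ∫ z, φ (h⁻¹ • (z : Eucl d)) ∂τ| ≤
      η * (h ^ m * (2 ^ m * volume.real (Metric.ball (0 : T) (2 * R)))) := by
    rw [hτ, integral_map hpm.aemeasurable (by fun_prop), ← integral_sub hi1 hi2]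
    have hAm : MeasurableSet ((fun a => p (a - x)) ⁻¹' Metric.ball (0 : T) (h * (2 * R))) :=
      hpm measurableSet_ball
    have hpt : ∀ a ∈ N, ‖φ (h⁻¹ • (a - x)) - φ (h⁻¹ • (p (a - x) : Eucl d))‖ ≤
        ((fun a => p (a - x)) ⁻¹' Metric.ball (0 : T) (h * (2 * R))).indicator (fun _ => η) a := by
      intro a ha
      have hax := hchord a ha x hxN
      have hpa : ‖p (a - x)‖ ≤ ‖a - x‖ := T.norm_orthogonalProjectionOnto_apply_le _
      by_cases hz : φ (h⁻¹ • (a - x)) = 0 ∧ φ (h⁻¹ • (p (a - x) : Eucl d)) = 0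
      · rw [hz.1, hz.2]
        simp only [sub_self, norm_zero]
        exact Set.indicator_nonneg (fun _ _ => hη0) _
      · have hlt : ‖a - x‖ < h * (2 * R) ∧ ‖p (a - x)‖ < h * (2 * R) := by
          rcases not_and_or.1 hz with hz | hz
          · have := hnz _ hz
            have hpos : 0 < h * R := by positivity
            constructor <;> linarith
          · have h1 := hnz _ hz
            have h2 := norm_le_of_norm_sub_orthogonalProjectionOnto_le hε1 hax
            have h3 : (1 - ε)⁻¹ ≤ 2 := by
              rw [inv_le_comm₀ (by linarith) two_pos]
              linarith
            have h4 : ‖p (a - x)‖ < h * R := h1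
            have h5 : ‖a - x‖ ≤ 2 * ‖p (a - x)‖ :=
              h2.trans (mul_le_mul_of_nonneg_right h3 (norm_nonneg _))
            have hpos : 0 < h * R := by positivity
            constructor <;> linarith
        rw [Set.indicator_of_mem (by simpa using hlt.2), Real.norm_eq_abs]
        -- Before rescaling, a point is moved by at most `ε ‖a - x‖ ≤ ε h (2 R)`. Division by `h`
        -- leaves the displacement at which `η` bounds the oscillation of `φ`.
        refine hη _ _ ?_
        rw [← smul_sub, norm_smul, norm_inv, Real.norm_of_nonneg hh.le, inv_mul_eq_div,
          div_le_iff₀ hh]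
        refine hax.trans ?_
        rw [mul_assoc, mul_comm (2 * R) h]
        exact mul_le_mul_of_nonneg_left hlt.1.le hε.le
    refine (norm_integral_le_of_norm_le ((integrable_const η).indicator hAm)
      ((ae_restrict_iff' hNm).2 (ae_of_all _ hpt))).trans ?_
    rw [integral_indicator_const _ hAm, smul_eq_mul, mul_comm]
    refine mul_le_mul_of_nonneg_left ?_ hη0
    refine le_trans (le_of_eq ?_) hball
    rw [measureReal_def, measureReal_def, hτ, Measure.map_apply hpm measurableSet_ball]
  -- comparison of the projected measure with Lebesgue measure
  have hφT : HasCompactSupport (fun z : T => φ z) :=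
    hφc.comp_isClosedEmbedding (T.closed_of_finiteDimensional.isClosedEmbedding_subtypeVal)
  have hTi : Integrable (fun z : T => φ z) :=
    (hφ.comp continuous_subtype_val).integrable_of_hasCompactSupport hφT
  have hTi' : Integrable (fun z : T => φ (h⁻¹ • (z : Eucl d))) :=
    (integrable_comp_smul_iff volume (fun z : T => φ z) (inv_ne_zero hh.ne')).2 hTi
  have hcmp := abs_integral_sub_le_of_measure_le (by
    have : (0 : ℝ) ≤ (1 - ε)⁻¹ := inv_nonneg.2 (by linarith)
    positivity) hlo hup hTi' (by
      intro z hz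
      by_contra hne
      have := hnz _ hne
      exact hz (mem_ball_zero_iff.2 (this.trans hr')))
  have hsc : ∀ ψ : T → ℝ, ∫ z : T, ψ (h⁻¹ • z) = h ^ m * ∫ z : T, ψ z := by
    intro ψ
    rw [Measure.integral_comp_inv_smul, hT, abs_of_pos (by positivity), smul_eq_mul]
  have hs1 := hsc (fun z => φ z)
  have hs2 := hsc (fun z => |φ z|)
  simp only [Submodule.coe_smul] at hs1 hs2
  rw [hs1, hs2] at hcmp
  have hhm : 0 < h ^ m := by positivity
  have hsum := (abs_sub_le _ _ _).trans (add_le_add hrepl hcmp)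
  rw [hSN]
  have heq : (h ^ m)⁻¹ * ∫ a in N, φ (h⁻¹ • (a - x)) ∂μHE[m] - ∫ z : T, φ z
      = (h ^ m)⁻¹ * (∫ a in N, φ (h⁻¹ • (a - x)) ∂μHE[m] - h ^ m * ∫ z : T, φ z) := by
    field_simp
  rw [heq, abs_mul, abs_of_pos (inv_pos.2 hhm), inv_mul_le_iff₀ hhm]
  refine hsum.trans_eq ?_
  ring

/-- Rescaled about a point with a tangent plane, the Hausdorff measure on a set converges vaguely
to Lebesgue measure on the tangent plane. -/
theorem tendsto_blowup {d m : ℕ} {S : Set (Eucl d)} (hS : MeasurableSet S)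
    (hfin : μHE[m] S < ⊤) {T : Submodule ℝ (Eucl d)} (hT : Module.finrank ℝ T = m)
    {x : Eucl d} (hx : x ∈ S) (htan : IsTangentAt S T x)
    {φ : Eucl d → ℝ} (hφ : Continuous φ) (hφc : HasCompactSupport φ) :
    Tendsto (fun h : ℝ => (h ^ m)⁻¹ * ∫ a in S, φ (h⁻¹ • (a - x)) ∂μHE[m]) (𝓝[>] 0)
      (𝓝 (∫ z : T, φ z)) := by
  obtain ⟨R, hR, hφR⟩ := exists_pos_radius hφc
  have huc := hφc.uniformContinuous_of_continuous hφ
  rw [Metric.tendsto_nhds]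
  intro κ hκ
  set V := 2 ^ m * volume.real (Metric.ball (0 : T) (2 * R)) with hV
  have hV0 : 0 ≤ V := by positivity
  set A := ∫ z : T, |φ z| with hA
  -- Half of the tolerance `κ` goes to moving points to the plane, half to the distortion of
  -- measure. The 1 added to `V` keeps the denominator positive.
  have hη : 0 < κ / (2 * (V + 1)) := by positivity
  obtain ⟨δ, hδ, hδφ⟩ := Metric.uniformContinuous_iff.1 huc _ hη
  have hlim : Tendsto (fun ε : ℝ => ((1 - ε)⁻¹ ^ m - 1) * A) (𝓝[>] 0) (𝓝 0) := by
    have hc : ContinuousAt (fun ε : ℝ => ((1 - ε)⁻¹ ^ m - 1) * A) 0 := by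
      have : ContinuousAt (fun ε : ℝ => (1 - ε)⁻¹) 0 :=
        ContinuousAt.inv₀ (by fun_prop) (by norm_num)
      fun_prop
    have := hc.tendsto
    simp only [sub_zero, inv_one, one_pow, sub_self, zero_mul] at this
    exact this.mono_left nhdsWithin_le_nhds
  have hlim2 : Tendsto (fun ε : ℝ => ε * (2 * R)) (𝓝[>] 0) (𝓝 0) := by
    have : Tendsto (fun ε : ℝ => ε * (2 * R)) (𝓝 0) (𝓝 (0 * (2 * R))) :=
      tendsto_id.mul_const _
    rw [zero_mul] at this
    exact this.mono_left nhdsWithin_le_nhds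
  obtain ⟨ε, hε1, hε2, hε3, hε⟩ := ((hlim.eventually_lt_const (half_pos hκ)).and
    ((hlim2.eventually_lt_const hδ).and ((((eventually_le_nhds
      (by norm_num : (0 : ℝ) < 1 / 2))).filter_mono nhdsWithin_le_nhds).and
      self_mem_nhdsWithin))).exists
  obtain ⟨r, hr, hchord, r', hr', hcover⟩ := htan ε hε
  have hsm : Tendsto (fun h : ℝ => h * R) (𝓝[>] 0) (𝓝 0) := by
    have : Tendsto (fun h : ℝ => h * R) (𝓝 0) (𝓝 (0 * R)) := tendsto_id.mul_const _
    rw [zero_mul] at this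
    exact this.mono_left nhdsWithin_le_nhds
  filter_upwards [hsm.eventually_lt_const hr, hsm.eventually_lt_const hr', self_mem_nhdsWithin]
    with h h1 h2 h3
  rw [Real.dist_eq]
  refine (abs_setIntegral_sub_integral_tangent_le hS hfin hT hx hφ hφc hφR hε hε3 hchord hcover
    (η := κ / (2 * (V + 1))) ?_ hη.le h3 hR h1 h2).trans_lt ?_
  · intro u v huv
    have := hδφ (a := u) (b := v) (by rw [dist_eq_norm]; exact huv.trans_lt hε2)
    rw [Real.dist_eq] at this
    exact this.le
  · have : κ / (2 * (V + 1)) * V ≤ κ / 2 := by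
      rw [div_mul_eq_mul_div, div_le_div_iff₀ (by positivity) two_pos]
      nlinarith
    linarith

/-! ### Autocorrelation of the kernel -/

/-- The autocorrelation `∫ K(u) K(u + z) du`. -/
def autocorrelation {d : ℕ} (K : Eucl d → ℝ) (z : Eucl d) : ℝ := ∫ u, K u * K (u + z)

lemma continuous_autocorrelation {d : ℕ} {K : Eucl d → ℝ} (hK : Continuous K)
    (hKc : HasCompactSupport K) : Continuous (autocorrelation K) := by
  obtain ⟨M, hM⟩ := hKc.exists_bound_of_continuous hK
  refine continuous_of_dominated (bound := fun u => ‖K u‖ * M) (fun z => by fun_prop)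
    (fun z => ae_of_all _ fun u => ?_)
    ((hK.integrable_of_hasCompactSupport hKc).norm.mul_const M) (ae_of_all _ fun u => by fun_prop)
  rw [norm_mul]
  gcongr
  exact hM _

lemma autocorrelation_eq_zero {d : ℕ} {K : Eucl d → ℝ} {R : ℝ} (hKR : ∀ z, R ≤ ‖z‖ → K z = 0)
    {z : Eucl d} (hz : 2 * R ≤ ‖z‖) : autocorrelation K z = 0 := by
  refine integral_eq_zero_of_ae (ae_of_all _ fun u => ?_)
  simp only [Pi.zero_apply, mul_eq_zero]
  by_contra! hcon
  have h1 : ‖u‖ < R := not_le.1 fun h => hcon.1 (hKR _ h)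
  have h2 : ‖u + z‖ < R := not_le.1 fun h => hcon.2 (hKR _ h)
  have h3 : ‖z‖ ≤ ‖u + z‖ + ‖u‖ := by simpa using norm_sub_le (u + z) u
  linarith

lemma hasCompactSupport_autocorrelation {d : ℕ} {K : Eucl d → ℝ}
    (hKc : HasCompactSupport K) : HasCompactSupport (autocorrelation K) := by
  obtain ⟨R, hR, hKR⟩ := exists_pos_radius hKc
  refine HasCompactSupport.intro (isCompact_closedBall 0 (2 * R)) fun z hz => ?_
  rw [mem_closedBall_zero_iff, not_le] at hz
  exact autocorrelation_eq_zero hKR hz.le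

/-! ### Slicing by parallel hyperplanes -/

section Slicing

variable {d : ℕ} {N : Eucl d}

/-- The orthogonal splitting of space into a line and its complement preserves volume, and a unit
vector identifies the line isometrically with `ℝ`. -/
lemma measurePreserving_add_smul (hN : ‖N‖ = 1) :
    MeasurePreserving (fun q : ℝ × (ℝ ∙ N)ᗮ => q.1 • N + (q.2 : Eucl d))
      (volume.prod volume) volume := by
  have h1 := ((ℝ ∙ N).measurePreserving_measurableEquivProd (0 : Eucl d)).symm
  rw [InnerProductSpace.euclideanHausdorffMeasure_eq_volume] at h1
  have h2 := ((LinearIsometryEquiv.toSpanUnitSingleton (𝕜 := ℝ) N hN).measurePreserving).prod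
    (MeasurePreserving.id (volume : Measure (ℝ ∙ N)ᗮ))
  have heq : (fun q : ℝ × (ℝ ∙ N)ᗮ => q.1 • N + (q.2 : Eucl d))
      = ((ℝ ∙ N).measurableEquivProd (0 : Eucl d)).symm ∘
        Prod.map (LinearIsometryEquiv.toSpanUnitSingleton (𝕜 := ℝ) N hN) id := by
    funext q
    simp
  rw [heq]
  exact h1.comp h2

lemma inner_eq_zero_of_mem (y : (ℝ ∙ N)ᗮ) : inner ℝ N (y : Eucl d) = 0 :=
  Submodule.mem_orthogonal_singleton_iff_inner_right.1 y.2

lemma norm_add_smul_sq (hN : ‖N‖ = 1) (t : ℝ) (y : (ℝ ∙ N)ᗮ) :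
    ‖t • N + (y : Eucl d)‖ ^ 2 = t ^ 2 + ‖y‖ ^ 2 := by
  rw [norm_add_sq_real, inner_smul_left, inner_eq_zero_of_mem, norm_smul, hN]
  simp

/-- The Fubini theorem for the autocorrelation of `K` along a hyperplane. -/
lemma integral_autocorrelation_orthogonal (hN : ‖N‖ = 1) {K : Eucl d → ℝ} (hK : Continuous K)
    (hKc : HasCompactSupport K) :
    ∫ z : (ℝ ∙ N)ᗮ, autocorrelation K z = ∫ t : ℝ, (∫ y : (ℝ ∙ N)ᗮ, K (t • N + y)) ^ 2 := by
  have hmp := measurePreserving_add_smul hN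
  obtain ⟨R, hR, hKR⟩ := exists_pos_radius hKc
  have hbd : ∀ (t : ℝ) (y : (ℝ ∙ N)ᗮ), K (t • N + y) ≠ 0 → |t| ≤ R ∧ ‖y‖ ≤ R := by
    intro t y hne
    have h1 : ‖t • N + (y : Eucl d)‖ < R := not_le.1 fun h => hne (hKR _ h)
    have h2 := norm_add_smul_sq hN t y
    have h3 : ‖t • N + (y : Eucl d)‖ ^ 2 ≤ R ^ 2 := pow_le_pow_left₀ (norm_nonneg _) h1.le 2
    constructor
    · exact abs_le_of_sq_le_sq (by nlinarith [sq_nonneg ‖y‖]) hR.le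
    · exact le_of_sq_le_sq (by nlinarith [sq_nonneg t]) hR.le
  have hinner : ∀ z : (ℝ ∙ N)ᗮ, autocorrelation K z
      = ∫ q : ℝ × (ℝ ∙ N)ᗮ, K (q.1 • N + q.2) * K (q.1 • N + q.2 + z) := by
    intro z
    rw [autocorrelation, ← hmp.map_eq, integral_map hmp.measurable.aemeasurable (by fun_prop)]
    rfl
  have hFint : Integrable (Function.uncurry fun (z : (ℝ ∙ N)ᗮ) (q : ℝ × (ℝ ∙ N)ᗮ) =>
      K (q.1 • N + q.2) * K (q.1 • N + q.2 + z)) (volume.prod volume) := by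
    refine Continuous.integrable_of_hasCompactSupport ?_ ?_
    · unfold Function.uncurry; fun_prop
    -- The two factors bound `t`, `y` and `y + z` by `R`, hence `z` by `2 R`.
    · refine HasCompactSupport.intro (isCompact_closedBall 0 (2 * R)) ?_
      rintro ⟨z, t, y⟩ hz
      by_contra hne
      obtain ⟨h1, h2⟩ := mul_ne_zero_iff.1 hne
      obtain ⟨ht, hy⟩ := hbd _ _ h1
      obtain ⟨-, hyz⟩ := hbd t (y + z) (by simpa [add_assoc] using h2)
      have hzn : ‖z‖ ≤ 2 * R := by
        have : ‖z‖ ≤ ‖y + z‖ + ‖y‖ := by simpa using norm_sub_le (y + z) y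
        linarith
      refine hz (mem_closedBall_zero_iff.2 ?_)
      simp only [Prod.norm_def, Real.norm_eq_abs, sup_le_iff]
      exact ⟨hzn, by linarith, by linarith⟩
  simp_rw [hinner]
  rw [integral_integral_swap hFint]
  have hz : ∀ q : ℝ × (ℝ ∙ N)ᗮ, ∫ z : (ℝ ∙ N)ᗮ, K (q.1 • N + q.2) * K (q.1 • N + q.2 + z)
      = K (q.1 • N + q.2) * ∫ y : (ℝ ∙ N)ᗮ, K (q.1 • N + y) := by
    rintro ⟨t, y⟩
    rw [integral_const_mul]
    congr 1
    -- Translation by `y` inside the hyperplane makes the inner integral depend on the slice `t`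
    -- only. Integrating over `y` then yields the square.
    rw [← integral_add_left_eq_self (fun y : (ℝ ∙ N)ᗮ => K (t • N + y)) y]
    simp [add_assoc]
  have hmarg := hFint.integral_prod_right
  simp only [Function.uncurry, hz] at hmarg
  simp_rw [hz]
  rw [Measure.volume_eq_prod, integral_prod _ hmarg]
  congr 1 with t
  simp only
  rw [integral_mul_const, sq]

/-- The affine hyperplane is an isometric copy of the linear one, on which the normalized Hausdorff
measure is Lebesgue measure. -/
lemma setIntegral_image_add_smul {m : ℕ} (hm : Module.finrank ℝ (ℝ ∙ N)ᗮ = m) {K : Eucl d → ℝ}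
    (hK : Continuous K) (t : ℝ) :
    ∫ u in (fun y => y + t • N) '' ((ℝ ∙ N)ᗮ : Set (Eucl d)), K u ∂μHE[m]
      = ∫ y : (ℝ ∙ N)ᗮ, K (t • N + y) := by
  have hiso : Isometry (fun y : (ℝ ∙ N)ᗮ => (y : Eucl d) + t • N) :=
    (isometry_add_right (t • N)).comp isometry_subtype_coe
  have hrange : (fun y => y + t • N) '' ((ℝ ∙ N)ᗮ : Set (Eucl d))
      = Set.range (fun y : (ℝ ∙ N)ᗮ => (y : Eucl d) + t • N) := Set.image_eq_range _ _
  rw [hrange, ← hiso.map_euclideanHausdorffMeasure,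
    integral_map hiso.continuous.measurable.aemeasurable (by fun_prop)]
  subst hm
  rw [InnerProductSpace.euclideanHausdorffMeasure_eq_volume]
  simp_rw [add_comm]

end Slicing

lemma norm_unitNormal {d : ℕ} {f : Eucl d → ℝ} {x : Eucl d} (hx : gradient f x ≠ 0) :
    ‖unitNormal f x‖ = 1 := by
  rw [unitNormal, norm_smul, norm_inv, norm_norm, inv_mul_cancel₀ (norm_ne_zero_iff.2 hx)]

lemma tangentSpace_eq {d : ℕ} {f : Eucl d → ℝ} {x : Eucl d} (hx : gradient f x ≠ 0) :
    tangentSpace f x = (ℝ ∙ unitNormal f x)ᗮ := by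
  rw [tangentSpace, unitNormal, Submodule.span_singleton_smul_eq
    (IsUnit.mk0 _ (inv_ne_zero (norm_ne_zero_iff.2 hx)))]

lemma finrank_tangentSpace {d : ℕ} {f : Eucl d → ℝ} {x : Eucl d} (hx : gradient f x ≠ 0) :
    Module.finrank ℝ (tangentSpace f x) = d - 1 := by
  have h := (ℝ ∙ gradient f x).finrank_add_finrank_orthogonal
  rw [finrank_span_singleton hx, finrank_euclideanSpace_fin] at h
  rw [tangentSpace]
  omega

/-- The roughness is the integral of the autocorrelation over the tangent space. -/
theorem roughness_eq_integral_autocorrelation {d : ℕ} {f K : Eucl d → ℝ} {x : Eucl d}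
    (hx : gradient f x ≠ 0) (hK : Continuous K) (hKc : HasCompactSupport K) :
    roughness f K x = ∫ z : tangentSpace f x, autocorrelation K z := by
  have hfr := finrank_tangentSpace hx
  rw [roughness]
  simp only [tangentPlane]
  rw [tangentSpace_eq hx] at hfr ⊢
  rw [integral_autocorrelation_orthogonal (norm_unitNormal hx) hK hKc]
  simp_rw [setIntegral_image_add_smul hfr hK]

/-! ### The smoothed surface measure -/

/-- A Fubini identity for the second moment of an integral transform with bounded kernel. -/
lemma integral_sq_integral_mul {X Y : Type*} [MeasurableSpace X] [MeasurableSpace Y]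
    {σ : Measure X} [IsFiniteMeasure σ] {μ : Measure Y} [IsFiniteMeasure μ] {w : X → ℝ}
    (hw : Measurable w) {C : ℝ} (hwC : ∀ x, |w x| ≤ C) {κ : X → Y → ℝ}
    (hκ : Measurable (Function.uncurry κ)) {M : ℝ} (hκM : ∀ x y, |κ x y| ≤ M) :
    ∫ y, (∫ x, w x * κ x y ∂σ) ^ 2 ∂μ
      = ∫ x, w x * ∫ x', w x' * ∫ y, κ x y * κ x' y ∂μ ∂σ ∂σ := by
  have hcomp : ∀ {Z : Type _} [MeasurableSpace Z] {u : Z → X} {v : Z → Y}, Measurable u →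
      Measurable v → Measurable fun z => κ (u z) (v z) := fun hu hv => hκ.comp (hu.prodMk hv)
  set G : Y → ℝ := fun y => ∫ x, w x * κ x y ∂σ with hG
  have hGm : Measurable G := by
    refine StronglyMeasurable.measurable ?_
    refine StronglyMeasurable.integral_prod_left' (f := fun z : X × Y => w z.1 * κ z.1 z.2) ?_
    exact ((hw.comp measurable_fst).mul (hcomp measurable_fst measurable_snd)).stronglyMeasurable
  have hGb : ∀ y, |G y| ≤ C * M * σ.real Set.univ := by
    intro y
    refine norm_integral_le_of_norm_le_const (μ := σ) (f := fun x => w x * κ x y)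
      (ae_of_all _ fun x => ?_)
    rw [Real.norm_eq_abs, abs_mul]
    exact mul_le_mul (hwC x) (hκM x y) (abs_nonneg _) ((abs_nonneg _).trans (hwC x))
  -- Only one factor of the square is opened, and the other is kept as a bounded measurable
  -- function. Two swaps of integrals over products of two spaces then replace a triple Fubini.
  have h1 : ∀ y, G y ^ 2 = ∫ x, w x * κ x y * G y ∂σ := by
    intro y; rw [integral_mul_const, sq]
  change ∫ y, G y ^ 2 ∂μ = _
  simp_rw [h1]
  rw [integral_integral_swap]
  · refine integral_congr_ae (ae_of_all _ fun x => ?_)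
    simp only
    have h2 : ∀ y, w x * κ x y * G y = w x * ∫ x', w x' * (κ x y * κ x' y) ∂σ := by
      intro y
      rw [mul_assoc, hG]
      simp only
      rw [← integral_const_mul]
      congr 2 with x'
      ring
    simp_rw [h2]
    rw [integral_const_mul, integral_integral_swap]
    · simp_rw [integral_const_mul]
    · refine Integrable.of_bound (C := C * (M * M)) ?_ (ae_of_all _ ?_)
      · exact ((hw.comp measurable_snd).mul ((hcomp measurable_const measurable_fst).mul
          (hcomp measurable_snd measurable_fst))).aestronglyMeasurable
      · rintro ⟨y, x'⟩
        simp only [Function.uncurry, norm_mul, Real.norm_eq_abs]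
        have hM : 0 ≤ M := (abs_nonneg _).trans (hκM x y)
        have hC : 0 ≤ C := (abs_nonneg _).trans (hwC x)
        have := hwC x'
        have := hκM x y
        have := hκM x' y
        gcongr
  · refine Integrable.of_bound (C := C * M * (C * M * σ.real Set.univ)) ?_ (ae_of_all _ ?_)
    · exact (((hw.comp measurable_snd).mul (hcomp measurable_snd measurable_fst)).mul
        (hGm.comp measurable_fst)).aestronglyMeasurable
    · rintro ⟨y, x⟩
      simp only [Function.uncurry, norm_mul, Real.norm_eq_abs]
      have hM : 0 ≤ M := (abs_nonneg _).trans (hκM x y)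
      have hC : 0 ≤ C := (abs_nonneg _).trans (hwC x)
      have := hwC x
      have := hκM x y
      have := hGb y
      gcongr

lemma integral_comp_inv_smul_sub {d : ℕ} {h : ℝ} (hh : 0 < h) (F : Eucl d → ℝ) (x : Eucl d) :
    ∫ y, F (h⁻¹ • (x - y)) = h ^ d * ∫ u, F u := by
  rw [integral_sub_left_eq_self (fun y => F (h⁻¹ • y)) volume x, Measure.integral_comp_inv_smul,
    finrank_euclideanSpace_fin, abs_of_pos (by positivity), smul_eq_mul]

lemma integrable_comp_inv_smul_sub {d : ℕ} {h : ℝ} (hh : 0 < h) {F : Eucl d → ℝ}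
    (hF : Integrable F) (x : Eucl d) : Integrable fun y => F (h⁻¹ • (x - y)) :=
  ((integrable_comp_smul_iff volume F (inv_ne_zero hh.ne')).2 hF).comp_sub_left x

/-! ### Means under the density of functions concentrated near a point. -/

/-- The measure with density `f`. -/
abbrev densityMeasure {d : ℕ} (f : Eucl d → ℝ) : Measure (Eucl d) :=
  volume.withDensity fun x => ENNReal.ofReal (f x)

section Density

variable {d : ℕ} {f : Eucl d → ℝ}

lemma integral_densityMeasure (hf : Measurable f) (hf0 : ∀ x, 0 ≤ f x) (g : Eucl d → ℝ) :
    ∫ y, g y ∂densityMeasure f = ∫ y, f y * g y := by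
  rw [densityMeasure, integral_withDensity_eq_integral_toReal_smul (by fun_prop)
    (ae_of_all _ fun _ => ENNReal.ofReal_lt_top)]
  simp_rw [ENNReal.toReal_ofReal (hf0 _), smul_eq_mul]

lemma integrable_of_isFiniteMeasure (hf : Measurable f) (hf0 : ∀ x, 0 ≤ f x)
    [IsFiniteMeasure (densityMeasure f)] : Integrable f := by
  refine ⟨hf.aestronglyMeasurable, ?_⟩
  rw [hasFiniteIntegral_iff_ofReal (ae_of_all _ hf0)]
  have := measure_lt_top (densityMeasure f) Set.univ
  rwa [withDensity_apply _ MeasurableSet.univ, Measure.restrict_univ] at this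

end Density

/-- The `f`-mean of the product of the kernels with bandwidth `h` centred at two points. -/
def kernelProduct {d : ℕ} (f K : Eucl d → ℝ) (h : ℝ) (x x' : Eucl d) : ℝ :=
  ∫ y, K (h⁻¹ • (x - y)) * K (h⁻¹ • (x' - y)) ∂densityMeasure f

section KernelProduct

variable {d : ℕ} {f K : Eucl d → ℝ} {R M : ℝ}

/-- The two kernels are supported in balls of radius `h R` about `x` and `x'`, which are too far
apart to overlap. -/
lemma kernelProduct_eq_zero (hKR : ∀ z, R ≤ ‖z‖ → K z = 0) {h : ℝ} (hh : 0 < h) {x x' : Eucl d}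
    (hx : h * (2 * R) ≤ ‖x' - x‖) : kernelProduct f K h x x' = 0 := by
  refine integral_eq_zero_of_ae (ae_of_all _ fun y => ?_)
  simp only [Pi.zero_apply, mul_eq_zero]
  by_contra! hcon
  have key : ∀ v, K (h⁻¹ • v) ≠ 0 → ‖v‖ < h * R := by
    intro v hv
    by_contra hc
    refine hv (hKR _ ?_)
    rw [norm_smul, norm_inv, Real.norm_of_nonneg hh.le, inv_mul_eq_div, le_div_iff₀ hh]
    linarith
  have h1 := key _ hcon.1
  have h2 := key _ hcon.2
  have h3 : ‖x' - x‖ ≤ ‖x' - y‖ + ‖x - y‖ := by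
    simpa using norm_sub_le (x' - y) (x - y)
  linarith

/-- On the ball that carries `g`, replacing `f` by the constant `c` costs at most `η` times an
integrable majorant `k` of `|g|`. -/
lemma abs_integral_densityMeasure_sub_le (hf : Measurable f) (hf0 : ∀ x, 0 ≤ f x)
    [IsFiniteMeasure (densityMeasure f)] {c η ρ : ℝ} (hη : 0 ≤ η) {x : Eucl d}
    (hfc : ∀ y, ‖y - x‖ < ρ → |f y - c| ≤ η) {g k : Eucl d → ℝ} (hg : Measurable g)
    (hk : Integrable k) {B : ℝ} (hgB : ∀ y, |g y| ≤ B) (hgk : ∀ y, |g y| ≤ k y)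
    (hgρ : ∀ y, ρ ≤ ‖y - x‖ → g y = 0) :
    |∫ y, g y ∂densityMeasure f - c * ∫ y, g y| ≤ η * ∫ y, k y := by
  have hgi : Integrable g := hk.mono' hg.aestronglyMeasurable (ae_of_all _ hgk)
  have hfg : Integrable fun y => f y * g y :=
    (integrable_of_isFiniteMeasure hf hf0).mul_bdd hg.aestronglyMeasurable (ae_of_all _ hgB)
  rw [integral_densityMeasure hf hf0, ← integral_const_mul, ← integral_sub hfg (hgi.const_mul c),
    ← integral_const_mul]
  refine norm_integral_le_of_norm_le (f := fun y => f y * g y - c * g y) (hk.const_mul η)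
    (ae_of_all _ fun y => ?_)
  rw [← sub_mul, norm_mul, Real.norm_eq_abs, Real.norm_eq_abs]
  rcases lt_or_ge ‖y - x‖ ρ with hy | hy
  · exact mul_le_mul (hfc y hy) (hgk y) (abs_nonneg _) ((abs_nonneg _).trans (hfc y hy))
  · have h0 : |g y| ≤ k y := hgk y
    rw [hgρ y hy, abs_zero] at h0
    rw [hgρ y hy, abs_zero, mul_zero]
    exact mul_nonneg hη h0

/-- Freezing the density at `c` leaves a Lebesgue integral, and the substitution `u = (x - y)/h`
turns it into `h ^ d` times the autocorrelation. The kernel at `x` localizes, and the one at `x'` is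
only bounded by `M`, so `x'` is arbitrary. -/
lemma abs_kernelProduct_sub_le (hf : Measurable f) (hf0 : ∀ x, 0 ≤ f x)
    [IsFiniteMeasure (densityMeasure f)] (hK : Continuous K) (hKc : HasCompactSupport K)
    (hKR : ∀ z, R ≤ ‖z‖ → K z = 0) (hKM : ∀ z, |K z| ≤ M) {c η ρ h : ℝ} (hη : 0 ≤ η) (hh : 0 < h)
    (hρ : h * R ≤ ρ) {x : Eucl d} (hfc : ∀ y, ‖y - x‖ < ρ → |f y - c| ≤ η) (x' : Eucl d) :
    |kernelProduct f K h x x' - c * (h ^ d * autocorrelation K (h⁻¹ • (x' - x)))|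
      ≤ η * (M * (h ^ d * ∫ u, |K u|)) := by
  have hM0 : 0 ≤ M := (abs_nonneg _).trans (hKM 0)
  have hcv : ∫ y, K (h⁻¹ • (x - y)) * K (h⁻¹ • (x' - y))
      = h ^ d * autocorrelation K (h⁻¹ • (x' - x)) := by
    rw [autocorrelation,
      ← integral_comp_inv_smul_sub hh (fun u => K u * K (u + h⁻¹ • (x' - x))) x]
    congr 1 with y
    rw [← smul_add]
    congr 3
    abel
  have hki : Integrable fun y => M * |K (h⁻¹ • (x - y))| :=
    ((integrable_comp_inv_smul_sub hh (hK.integrable_of_hasCompactSupport hKc) x).abs).const_mul M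
  have h := abs_integral_densityMeasure_sub_le hf hf0 hη hfc
    (g := fun y => K (h⁻¹ • (x - y)) * K (h⁻¹ • (x' - y))) (k := fun y => M * |K (h⁻¹ • (x - y))|)
    (by fun_prop) hki (B := M * M) (fun y => by
      rw [abs_mul]; exact mul_le_mul (hKM _) (hKM _) (abs_nonneg _) hM0)
    (fun y => by
      rw [abs_mul, mul_comm]; exact mul_le_mul_of_nonneg_right (hKM _) (abs_nonneg _))
    (fun y hy => by
      rw [hKR (h⁻¹ • (x - y)), zero_mul]
      rw [norm_smul, norm_inv, Real.norm_of_nonneg hh.le, inv_mul_eq_div, le_div_iff₀ hh,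
        norm_sub_rev]
      linarith)
  rw [hcv, integral_const_mul, integral_comp_inv_smul_sub hh (fun u => |K u|) x] at h
  exact h

lemma measurable_kernelProduct [SFinite (densityMeasure f)] (hK : Continuous K) (h : ℝ) :
    Measurable fun q : Eucl d × Eucl d => kernelProduct f K h q.1 q.2 := by
  refine StronglyMeasurable.measurable ?_
  refine StronglyMeasurable.integral_prod_right'
    (f := fun z : (Eucl d × Eucl d) × Eucl d =>
      K (h⁻¹ • (z.1.1 - z.2)) * K (h⁻¹ • (z.1.2 - z.2))) ?_
  exact Continuous.stronglyMeasurable (by fun_prop)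

end KernelProduct

/-! ### Surface integrals of functions concentrated near a point -/

section Surface

variable {d m : ℕ} {S : Set (Eucl d)} {A r₀ : ℝ}

/-- Used with `ρ` proportional to `h`: the resulting `h ^ m` cancels the normalization `(h ^ m)⁻¹`
of rescaled surface integrals. -/
lemma abs_setIntegral_le_of_local (hS : MeasurableSet S)
    (hA : ∀ x ∈ S, ∀ r > 0, r ≤ r₀ → μHE[m] (S ∩ Metric.ball x r) ≤ ENNReal.ofReal (A * r ^ m))
    (hA0 : 0 ≤ A) {x : Eucl d} (hx : x ∈ S) {F : Eucl d → ℝ} {b ρ : ℝ} (hρ : 0 < ρ) (hρr : ρ ≤ r₀)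
    (hb : 0 ≤ b) (hF : ∀ a ∈ S, |F a| ≤ b) (hF0 : ∀ a ∈ S, ρ ≤ ‖a - x‖ → F a = 0) :
    |∫ a in S, F a ∂μHE[m]| ≤ b * (A * ρ ^ m) := by
  have hAx := hA x hx ρ hρ hρr
  rw [setIntegral_eq_of_subset_of_forall_sdiff_eq_zero hS
    (Set.inter_subset_left : S ∩ Metric.ball x ρ ⊆ S)]
  · refine (norm_setIntegral_le_of_norm_le_const (f := F) (C := b) (hAx.trans_lt ENNReal.ofReal_lt_top)
      (fun a ha => hF a ha.1)).trans ?_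
    refine mul_le_mul_of_nonneg_left ?_ hb
    exact ENNReal.toReal_le_of_le_ofReal (by positivity) hAx
  · rintro a ⟨haS, ha⟩
    refine hF0 a haS ?_
    by_contra hc
    exact ha ⟨haS, by rw [Metric.mem_ball, dist_eq_norm]; linarith⟩

end Surface

/-! ### Asymptotic variance -/

/-- A compact set `S` with tangent planes `T x` of dimension `m`, a probability density `f` that
approaches `c` near `S`, a kernel `K`, and a weight `w` that is continuous on `S`. -/
structure SurfaceSetup {d : ℕ} (m : ℕ) (S : Set (Eucl d)) (T : Eucl d → Submodule ℝ (Eucl d))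
    (f K w : Eucl d → ℝ) (c C : ℝ) : Prop where
  isCompact : IsCompact S
  finrank_eq : ∀ x ∈ S, Module.finrank ℝ (T x) = m
  isTangentAt : ∀ x ∈ S, IsTangentAt S (T x) x
  measurable_density : Measurable f
  density_nonneg : ∀ x, 0 ≤ f x
  isProbabilityMeasure : IsProbabilityMeasure (densityMeasure f)
  density_near : ∀ η > 0, ∃ ρ > 0, ∀ x ∈ S, ∀ y, ‖y - x‖ < ρ → |f y - c| ≤ η
  continuous_kernel : Continuous K
  hasCompactSupport_kernel : HasCompactSupport K
  measurable_weight : Measurable w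
  weight_le : ∀ x, |w x| ≤ C
  continuousOn_weight : ContinuousOn w S

/-- The surface measure smoothed by the kernel with bandwidth `h`. -/
def smoothedSurface {d : ℕ} (m : ℕ) (S : Set (Eucl d)) (K w : Eucl d → ℝ) (h : ℝ)
    (y : Eucl d) : ℝ :=
  ∫ x in S, w x * K (h⁻¹ • (x - y)) ∂μHE[m]

/-- The contribution of the point `x` to the second moment of the smoothed surface measure. -/
def localVariance {d : ℕ} (m : ℕ) (S : Set (Eucl d)) (f K w : Eucl d → ℝ) (h : ℝ)
    (x : Eucl d) : ℝ :=
  (h ^ m)⁻¹ * ∫ a in S, w a * ((h ^ d)⁻¹ * kernelProduct f K h x a) ∂μHE[m]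

lemma tendsto_zero_of_forall_eventually_le {ι : Type*} {l : Filter ι} {D : ι → ℝ} {Q : ℝ}
    (hQ : 0 ≤ Q) (H : ∀ η > 0, ∀ᶠ i in l, |D i| ≤ η * Q) : Tendsto D l (𝓝 0) := by
  rw [Metric.tendsto_nhds]
  intro κ hκ
  filter_upwards [H (κ / (Q + 1)) (by positivity)] with i hi
  rw [dist_zero_right, Real.norm_eq_abs]
  refine hi.trans_lt ?_
  rw [div_mul_eq_mul_div, div_lt_iff₀ (by positivity)]
  nlinarith

lemma eventually_mul_const_lt {ρ : ℝ} (hρ : 0 < ρ) (R : ℝ) :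
    ∀ᶠ h : ℝ in 𝓝[>] 0, h * R < ρ := by
  have : Tendsto (fun h : ℝ => h * R) (𝓝 0) (𝓝 (0 * R)) := tendsto_id.mul_const _
  rw [zero_mul] at this
  exact (this.mono_left nhdsWithin_le_nhds).eventually_lt_const hρ

namespace SurfaceSetup

variable {d m : ℕ} {S : Set (Eucl d)} {T : Eucl d → Submodule ℝ (Eucl d)}
  {f K w : Eucl d → ℝ} {c C : ℝ}

lemma measurableSet (H : SurfaceSetup m S T f K w c C) : MeasurableSet S :=
  H.isCompact.isClosed.measurableSet

lemma exists_tangent (H : SurfaceSetup m S T f K w c C) :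
    ∀ x ∈ S, ∃ T : Submodule ℝ (Eucl d), Module.finrank ℝ T = m ∧ IsTangentAt S T x :=
  fun x hx => ⟨T x, H.finrank_eq x hx, H.isTangentAt x hx⟩

lemma measure_lt_top (H : SurfaceSetup m S T f K w c C) : μHE[m] S < ⊤ :=
  measure_lt_top_of_isTangentAt H.isCompact H.exists_tangent

lemma isFiniteMeasure (H : SurfaceSetup m S T f K w c C) :
    IsFiniteMeasure ((μHE[m] : Measure (Eucl d)).restrict S) :=
  ⟨by rw [Measure.restrict_apply_univ]; exact H.measure_lt_top⟩

lemma const_nonneg (H : SurfaceSetup m S T f K w c C) : 0 ≤ C :=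
  (abs_nonneg _).trans (H.weight_le 0)

lemma abs_kernelProduct_le (H : SurfaceSetup m S T f K w c C) {M : ℝ} (hM : ∀ z, |K z| ≤ M)
    (h : ℝ) (x a : Eucl d) : |kernelProduct f K h x a| ≤ M * M := by
  have := H.isProbabilityMeasure
  have hM0 : 0 ≤ M := (abs_nonneg _).trans (hM 0)
  refine (norm_integral_le_of_norm_le_const (μ := densityMeasure f) (C := M * M)
    (f := fun y => K (h⁻¹ • (x - y)) * K (h⁻¹ • (a - y))) (ae_of_all _ fun y => ?_)).trans_eq ?_
  · rw [Real.norm_eq_abs, abs_mul]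
    exact mul_le_mul (hM _) (hM _) (abs_nonneg _) hM0
  · simp

lemma measurable_kernelProduct (H : SurfaceSetup m S T f K w c C) (h : ℝ) :
    Measurable fun q : Eucl d × Eucl d => kernelProduct f K h q.1 q.2 := by
  have := H.isProbabilityMeasure
  exact LevelSetKDE.measurable_kernelProduct H.continuous_kernel h

lemma measurable_localVariance (H : SurfaceSetup m S T f K w c C) (h : ℝ) :
    Measurable (localVariance m S f K w h) := by
  have := H.isFiniteMeasure
  refine Measurable.const_mul (StronglyMeasurable.measurable ?_) _
  refine StronglyMeasurable.integral_prod_right'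
    (f := fun z : Eucl d × Eucl d => w z.2 * ((h ^ d)⁻¹ * kernelProduct f K h z.1 z.2)) ?_
  exact ((H.measurable_weight.comp measurable_snd).mul
    ((H.measurable_kernelProduct h).const_mul _)).stronglyMeasurable

/-- The rescaled products of kernels approach the autocorrelation, uniformly on the surface. -/
lemma eventually_abs_kernelProduct_sub_le (H : SurfaceSetup m S T f K w c C) {M R : ℝ}
    (hM : ∀ z, |K z| ≤ M) (hKR : ∀ z, R ≤ ‖z‖ → K z = 0) {η : ℝ} (hη : 0 < η) :
    ∀ᶠ h : ℝ in 𝓝[>] 0, ∀ x ∈ S, ∀ a,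
      |(h ^ d)⁻¹ * kernelProduct f K h x a - c * autocorrelation K (h⁻¹ • (a - x))|
        ≤ η * (M * ∫ u, |K u|) := by
  have := H.isProbabilityMeasure
  obtain ⟨ρ, hρ, hfρ⟩ := H.density_near η hη
  filter_upwards [eventually_mul_const_lt hρ R, self_mem_nhdsWithin] with h h1 (h2 : 0 < h) x hx a
  have hhd : 0 < h ^ d := by positivity
  have h3 := abs_kernelProduct_sub_le H.measurable_density H.density_nonneg H.continuous_kernel
    H.hasCompactSupport_kernel hKR hM hη.le h2 h1.le (hfρ x hx) a
  have heq : (h ^ d)⁻¹ * kernelProduct f K h x a - c * autocorrelation K (h⁻¹ • (a - x))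
      = (h ^ d)⁻¹ * (kernelProduct f K h x a
        - c * (h ^ d * autocorrelation K (h⁻¹ • (a - x)))) := by
    field_simp
  rw [heq, abs_mul, abs_of_pos (inv_pos.2 hhd), inv_mul_le_iff₀ hhd]
  refine h3.trans_eq ?_
  ring

/-- Supplies the constant dominating function for passing to the limit under the surface integral.
-/
lemma exists_localVariance_le (H : SurfaceSetup m S T f K w c C) :
    ∃ B, ∀ᶠ h : ℝ in 𝓝[>] 0, ∀ x ∈ S, |localVariance m S f K w h x| ≤ B := by
  obtain ⟨M, hM⟩ := H.hasCompactSupport_kernel.exists_bound_of_continuous H.continuous_kernel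
  obtain ⟨R, hR, hKR⟩ := exists_pos_radius H.hasCompactSupport_kernel
  obtain ⟨MΦ, hMΦ⟩ := (hasCompactSupport_autocorrelation
    H.hasCompactSupport_kernel).exists_bound_of_continuous
    (continuous_autocorrelation H.continuous_kernel H.hasCompactSupport_kernel)
  obtain ⟨A, hA0, r₀, hr₀, hA⟩ := exists_measure_inter_ball_le H.isCompact H.exists_tangent
  have hM0 : 0 ≤ M := (norm_nonneg _).trans (hM 0)
  have hMΦ0 : 0 ≤ MΦ := (norm_nonneg _).trans (hMΦ 0)
  have hL : 0 ≤ ∫ u, |K u| := integral_nonneg fun _ => abs_nonneg _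
  have hC := H.const_nonneg
  refine ⟨C * (M * (∫ u, |K u|) + |c| * MΦ) * (A * (2 * R) ^ m), ?_⟩
  filter_upwards [H.eventually_abs_kernelProduct_sub_le hM hKR one_pos,
    eventually_mul_const_lt hr₀ (2 * R), self_mem_nhdsWithin] with h h1 h2 (h3 : 0 < h) x hx
  have hhm : 0 < h ^ m := by positivity
  rw [localVariance, abs_mul, abs_of_pos (inv_pos.2 hhm), inv_mul_le_iff₀ hhm]
  refine (abs_setIntegral_le_of_local H.measurableSet hA hA0.le hx
    (b := C * (M * (∫ u, |K u|) + |c| * MΦ)) (by positivity : 0 < h * (2 * R)) h2.le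
    (by positivity) (fun a _ => ?_) (fun a _ ha => ?_)).trans_eq (by ring)
  · rw [abs_mul]
    refine mul_le_mul (H.weight_le a) ?_ (abs_nonneg _) hC
    have h4 := h1 x hx a
    rw [one_mul] at h4
    have h5 : |c * autocorrelation K (h⁻¹ • (a - x))| ≤ |c| * MΦ := by
      rw [abs_mul]; exact mul_le_mul_of_nonneg_left (hMΦ _) (abs_nonneg _)
    have h6 := abs_add_le ((h ^ d)⁻¹ * kernelProduct f K h x a
      - c * autocorrelation K (h⁻¹ • (a - x))) (c * autocorrelation K (h⁻¹ • (a - x)))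
    rw [sub_add_cancel] at h6
    linarith
  · rw [kernelProduct_eq_zero hKR h3 ha, mul_zero, mul_zero]

lemma tendsto_localVariance (H : SurfaceSetup m S T f K w c C) {x : Eucl d} (hx : x ∈ S) :
    Tendsto (fun h => localVariance m S f K w h x) (𝓝[>] 0)
      (𝓝 (w x * c * ∫ z : T x, autocorrelation K z)) := by
  have := H.isFiniteMeasure
  have hΦ := continuous_autocorrelation H.continuous_kernel H.hasCompactSupport_kernel
  have hΦc := hasCompactSupport_autocorrelation H.hasCompactSupport_kernel
  obtain ⟨M, hM⟩ := H.hasCompactSupport_kernel.exists_bound_of_continuous H.continuous_kernel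
  obtain ⟨R, hR, hKR⟩ := exists_pos_radius H.hasCompactSupport_kernel
  obtain ⟨MΦ, hMΦ⟩ := hΦc.exists_bound_of_continuous hΦ
  obtain ⟨A, hA0, r₀, hr₀, hA⟩ := exists_measure_inter_ball_le H.isCompact H.exists_tangent
  have hM0 : 0 ≤ M := (norm_nonneg _).trans (hM 0)
  have hMΦ0 : 0 ≤ MΦ := (norm_nonneg _).trans (hMΦ 0)
  have hL : 0 ≤ ∫ u, |K u| := integral_nonneg fun _ => abs_nonneg _
  have hC := H.const_nonneg
  have hblow := (tendsto_blowup H.measurableSet H.measure_lt_top (H.finrank_eq x hx) hx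
    (H.isTangentAt x hx) hΦ hΦc).const_mul (w x * c)
  have hdiff : Tendsto (fun h => localVariance m S f K w h x - w x * c *
      ((h ^ m)⁻¹ * ∫ a in S, autocorrelation K (h⁻¹ • (a - x)) ∂μHE[m])) (𝓝[>] 0) (𝓝 0) := by
    refine tendsto_zero_of_forall_eventually_le
      (Q := (C * (M * ∫ u, |K u|) + |c| * MΦ) * (A * (2 * R) ^ m)) (by positivity) fun η hη => ?_
    obtain ⟨ρ, hρ, hwρ⟩ := Metric.continuousOn_iff.1 H.continuousOn_weight x hx η hη
    filter_upwards [H.eventually_abs_kernelProduct_sub_le hM hKR hη,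
      eventually_mul_const_lt hr₀ (2 * R), eventually_mul_const_lt hρ (2 * R),
      self_mem_nhdsWithin] with h h1 h2 h2' (h3 : 0 < h)
    have hhm : 0 < h ^ m := by positivity
    have i1 : Integrable (fun a => w a * ((h ^ d)⁻¹ * kernelProduct f K h x a))
        ((μHE[m] : Measure (Eucl d)).restrict S) := by
      refine Integrable.of_bound (C := C * ((h ^ d)⁻¹ * (M * M))) ?_ (ae_of_all _ fun a => ?_)
      · exact (H.measurable_weight.mul (((H.measurable_kernelProduct h).comp
          measurable_prodMk_left).const_mul _)).aestronglyMeasurable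
      · rw [norm_mul, norm_mul, Real.norm_eq_abs, Real.norm_eq_abs, Real.norm_eq_abs,
          abs_of_pos (by positivity : 0 < (h ^ d)⁻¹)]
        have := H.weight_le a
        have := H.abs_kernelProduct_le hM h x a
        gcongr
    have i2 : Integrable (fun a => w x * c * autocorrelation K (h⁻¹ • (a - x)))
        ((μHE[m] : Measure (Eucl d)).restrict S) :=
      (Integrable.of_bound (C := MΦ) (by fun_prop) (ae_of_all _ fun a => hMΦ _)).const_mul _
    have heq : localVariance m S f K w h x - w x * c *
        ((h ^ m)⁻¹ * ∫ a in S, autocorrelation K (h⁻¹ • (a - x)) ∂μHE[m])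
        = (h ^ m)⁻¹ * ∫ a in S, (w a * ((h ^ d)⁻¹ * kernelProduct f K h x a)
          - w x * c * autocorrelation K (h⁻¹ • (a - x))) ∂μHE[m] := by
      rw [integral_sub i1 i2, integral_const_mul, localVariance]
      ring
    rw [heq, abs_mul, abs_of_pos (inv_pos.2 hhm), inv_mul_le_iff₀ hhm]
    have hzero : ∀ a, h * (2 * R) ≤ ‖a - x‖ → autocorrelation K (h⁻¹ • (a - x)) = 0 := by
      intro a ha
      refine autocorrelation_eq_zero hKR ?_
      rw [norm_smul, norm_inv, Real.norm_of_nonneg h3.le, inv_mul_eq_div, le_div_iff₀ h3]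
      linarith
    refine (abs_setIntegral_le_of_local H.measurableSet hA hA0.le hx
      (b := η * (C * (M * (∫ u, |K u|)) + |c| * MΦ)) (by positivity : 0 < h * (2 * R)) h2.le
      (by positivity) (fun a ha => ?_) (fun a _ ha => ?_)).trans_eq (by ring)
    · rcases lt_or_ge ‖a - x‖ (h * (2 * R)) with hax | hax
      · have h4 : |w a - w x| ≤ η := by
          have := hwρ a ha (by rw [dist_eq_norm]; linarith)
          rw [Real.dist_eq] at this
          exact this.le
        have h5 := h1 x hx a
        have h6 : |autocorrelation K (h⁻¹ • (a - x))| ≤ MΦ := hMΦ _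
        -- The error splits into freezing the density at `c` and freezing the weight at `x`.
        have h7 : w a * ((h ^ d)⁻¹ * kernelProduct f K h x a)
            - w x * c * autocorrelation K (h⁻¹ • (a - x))
            = w a * ((h ^ d)⁻¹ * kernelProduct f K h x a
              - c * autocorrelation K (h⁻¹ • (a - x)))
              + (w a - w x) * (c * autocorrelation K (h⁻¹ • (a - x))) := by ring
        rw [h7]
        refine (abs_add_le _ _).trans ?_
        rw [abs_mul, abs_mul, abs_mul]
        have h8 := H.weight_le a
        calc _ ≤ C * (η * (M * ∫ u, |K u|)) + η * (|c| * MΦ) := by gcongr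
          _ = _ := by ring
      · rw [kernelProduct_eq_zero hKR h3 hax, hzero a hax]
        simp only [mul_zero, sub_zero, abs_zero]
        positivity
    · rw [kernelProduct_eq_zero hKR h3 ha, hzero a ha]
      simp
  have := hdiff.add hblow
  rw [zero_add] at this
  exact this.congr fun h => by ring

/-- Integrals over the tangent spaces depend measurably on the point and are bounded. -/
lemma aestronglyMeasurable_integral_tangent (H : SurfaceSetup m S T f K w c C) :
    AEStronglyMeasurable (fun x => ∫ z : T x, autocorrelation K z)
      ((μHE[m] : Measure (Eucl d)).restrict S) := by
  have := H.isFiniteMeasure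
  have hΦ := continuous_autocorrelation H.continuous_kernel H.hasCompactSupport_kernel
  have hΦc := hasCompactSupport_autocorrelation H.hasCompactSupport_kernel
  -- The blow-ups at each scale are measurable in the centre and converge pointwise on `S`, so no
  -- regularity of `x ↦ T x` is needed.
  refine aestronglyMeasurable_of_tendsto_ae (𝓝[>] (0 : ℝ))
    (f := fun h x => (h ^ m)⁻¹ * ∫ a in S, autocorrelation K (h⁻¹ • (a - x)) ∂μHE[m])
    (fun h => ?_) ?_
  · refine AEStronglyMeasurable.const_mul (StronglyMeasurable.aestronglyMeasurable ?_) _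
    refine StronglyMeasurable.integral_prod_right'
      (f := fun z : Eucl d × Eucl d => autocorrelation K (h⁻¹ • (z.2 - z.1))) ?_
    exact Continuous.stronglyMeasurable (by fun_prop)
  · refine (ae_restrict_iff' H.measurableSet).2 (ae_of_all _ fun x hx => ?_)
    exact tendsto_blowup H.measurableSet H.measure_lt_top (H.finrank_eq x hx) hx
      (H.isTangentAt x hx) hΦ hΦc

lemma exists_integral_tangent_le (H : SurfaceSetup m S T f K w c C) :
    ∃ B, ∀ x ∈ S, |∫ z : T x, autocorrelation K z| ≤ B := by
  have hΦ := continuous_autocorrelation H.continuous_kernel H.hasCompactSupport_kernel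
  have hΦc := hasCompactSupport_autocorrelation H.hasCompactSupport_kernel
  obtain ⟨R, hR, hKR⟩ := exists_pos_radius hΦc
  obtain ⟨MΦ, hMΦ⟩ := hΦc.exists_bound_of_continuous hΦ
  obtain ⟨A, hA0, r₀, hr₀, hA⟩ := exists_measure_inter_ball_le H.isCompact H.exists_tangent
  have hMΦ0 : 0 ≤ MΦ := (norm_nonneg _).trans (hMΦ 0)
  refine ⟨MΦ * (A * R ^ m), fun x hx => ?_⟩
  refine le_of_tendsto (tendsto_blowup H.measurableSet H.measure_lt_top (H.finrank_eq x hx) hx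
      (H.isTangentAt x hx) hΦ hΦc).abs ?_
  filter_upwards [eventually_mul_const_lt hr₀ R, self_mem_nhdsWithin] with h h2 (h3 : 0 < h)
  have hhm : 0 < h ^ m := by positivity
  rw [abs_mul, abs_of_pos (inv_pos.2 hhm), inv_mul_le_iff₀ hhm]
  refine (abs_setIntegral_le_of_local H.measurableSet hA hA0.le hx
    (b := MΦ) (by positivity : 0 < h * R) h2.le hMΦ0 (fun a _ => hMΦ _)
    (fun a _ ha => hKR _ ?_)).trans_eq (by ring)
  rw [norm_smul, norm_inv, Real.norm_of_nonneg h3.le, inv_mul_eq_div, le_div_iff₀ h3]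
  linarith

lemma integrable_sq_mul_integral_tangent (H : SurfaceSetup m S T f K w c C) :
    IntegrableOn (fun x => w x ^ 2 * ∫ z : T x, autocorrelation K z) S μHE[m] := by
  have := H.isFiniteMeasure
  obtain ⟨B, hB⟩ := H.exists_integral_tangent_le
  refine Integrable.of_bound (C := C ^ 2 * B)
    ((H.measurable_weight.pow_const 2).aestronglyMeasurable.mul
      H.aestronglyMeasurable_integral_tangent)
    ((ae_restrict_iff' H.measurableSet).2 (ae_of_all _ fun x hx => ?_))
  rw [norm_mul, norm_pow, Real.norm_eq_abs, Real.norm_eq_abs]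
  have := H.weight_le x
  have := hB x hx
  gcongr

/-- The second moment of the smoothed surface measure. -/
theorem tendsto_integral_smoothedSurface_sq (H : SurfaceSetup m S T f K w c C) :
    Tendsto (fun h : ℝ => (h ^ m * h ^ d)⁻¹ *
        ∫ y, smoothedSurface m S K w h y ^ 2 ∂densityMeasure f) (𝓝[>] 0)
      (𝓝 (c * ∫ x in S, w x ^ 2 * (∫ z : T x, autocorrelation K z) ∂μHE[m])) := by
  have := H.isFiniteMeasure
  have := H.isProbabilityMeasure
  obtain ⟨M, hM⟩ := H.hasCompactSupport_kernel.exists_bound_of_continuous H.continuous_kernel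
  obtain ⟨B, hB⟩ := H.exists_localVariance_le
  have hlim : Tendsto (fun h : ℝ => ∫ x in S, w x * localVariance m S f K w h x ∂μHE[m]) (𝓝[>] 0)
      (𝓝 (∫ x in S, w x * (w x * c * (∫ z : T x, autocorrelation K z)) ∂μHE[m])) := by
    refine tendsto_integral_filter_of_dominated_convergence (fun _ => C * B) ?_ ?_
      (integrable_const _) ?_
    · exact Eventually.of_forall fun h =>
        (H.measurable_weight.mul (H.measurable_localVariance h)).aestronglyMeasurable
    · filter_upwards [hB] with h hh
      refine (ae_restrict_iff' H.measurableSet).2 (ae_of_all _ fun x hx => ?_)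
      rw [norm_mul, Real.norm_eq_abs, Real.norm_eq_abs]
      exact mul_le_mul (H.weight_le x) (hh x hx) (abs_nonneg _) H.const_nonneg
    · refine (ae_restrict_iff' H.measurableSet).2 (ae_of_all _ fun x hx => ?_)
      exact (H.tendsto_localVariance hx).const_mul _
  have hval : ∫ x in S, w x * (w x * c * (∫ z : T x, autocorrelation K z)) ∂μHE[m]
      = c * ∫ x in S, w x ^ 2 * (∫ z : T x, autocorrelation K z) ∂μHE[m] := by
    rw [← integral_const_mul]
    congr 1 with x
    ring
  rw [hval] at hlim
  refine hlim.congr fun h => ?_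
  have hfub := integral_sq_integral_mul (σ := (μHE[m] : Measure (Eucl d)).restrict S)
    (μ := densityMeasure f) H.measurable_weight H.weight_le
    (κ := fun x y => K (h⁻¹ • (x - y))) (Continuous.measurable (by
      have := H.continuous_kernel; unfold Function.uncurry; fun_prop)) (fun x y => hM _)
  simp only [smoothedSurface]
  rw [hfub, ← integral_const_mul]
  refine integral_congr_ae (ae_of_all _ fun x => ?_)
  simp only [localVariance]
  have h1 : ∫ a in S, w a * ((h ^ d)⁻¹ * kernelProduct f K h x a) ∂μHE[m]
      = (h ^ d)⁻¹ * ∫ a in S, w a * kernelProduct f K h x a ∂μHE[m] := by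
    rw [← integral_const_mul]
    congr 1 with a
    ring
  rw [h1, mul_inv]
  simp only [kernelProduct]
  ring

lemma measurable_smoothedSurface (H : SurfaceSetup m S T f K w c C) (h : ℝ) :
    Measurable (smoothedSurface m S K w h) := by
  have := H.isFiniteMeasure
  refine StronglyMeasurable.measurable ?_
  refine StronglyMeasurable.integral_prod_left'
    (f := fun z : Eucl d × Eucl d => w z.1 * K (h⁻¹ • (z.1 - z.2))) ?_
  have hK := H.continuous_kernel
  exact ((H.measurable_weight.comp measurable_fst).mul
    (Continuous.measurable (by fun_prop))).stronglyMeasurable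

/-- The smoothed surface measure is of order `h ^ m`, uniformly. -/
lemma exists_smoothedSurface_le (H : SurfaceSetup m S T f K w c C) :
    ∃ B, ∀ᶠ h : ℝ in 𝓝[>] 0, ∀ y, |smoothedSurface m S K w h y| ≤ B * h ^ m := by
  obtain ⟨M, hM⟩ := H.hasCompactSupport_kernel.exists_bound_of_continuous H.continuous_kernel
  obtain ⟨R, hR, hKR⟩ := exists_pos_radius H.hasCompactSupport_kernel
  obtain ⟨A, hA0, r₀, hr₀, hA⟩ := exists_measure_inter_ball_le H.isCompact H.exists_tangent
  have hM0 : 0 ≤ M := (norm_nonneg _).trans (hM 0)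
  have hC := H.const_nonneg
  refine ⟨C * M * (A * (2 * R) ^ m), ?_⟩
  filter_upwards [eventually_mul_const_lt hr₀ (2 * R), self_mem_nhdsWithin] with h h2 (h3 : 0 < h) y
  have key : ∀ v, h * R ≤ ‖v‖ → K (h⁻¹ • v) = 0 := by
    intro v hv
    refine hKR _ ?_
    rw [norm_smul, norm_inv, Real.norm_of_nonneg h3.le, inv_mul_eq_div, le_div_iff₀ h3]
    linarith
  -- The mass bound holds for balls centred on `S`, while `y` is arbitrary. A point `x` of `S` near
  -- `y` serves as centre, at the price of doubling the radius. Without such a point the integrand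
  -- vanishes on `S`.
  by_cases hex : ∃ x ∈ S, ‖x - y‖ < h * R
  · obtain ⟨x, hx, hxy⟩ := hex
    refine (abs_setIntegral_le_of_local H.measurableSet hA hA0.le hx (b := C * M)
      (by positivity : 0 < h * (2 * R)) h2.le (by positivity) (fun a _ => ?_)
      (fun a _ ha => ?_)).trans_eq (by ring)
    · rw [abs_mul]
      exact mul_le_mul (H.weight_le a) (hM _) (abs_nonneg _) hC
    · rw [key, mul_zero]
      have : ‖a - x‖ ≤ ‖a - y‖ + ‖x - y‖ := by simpa using norm_sub_le (a - y) (x - y)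
      linarith
  · push Not at hex
    rw [smoothedSurface, setIntegral_eq_zero_of_forall_eq_zero
      (fun a ha => by rw [key _ (hex a ha), mul_zero]), abs_zero]
    positivity

/-- The mean of the smoothed surface measure is an iterated integral in either order. -/
lemma integral_smoothedSurface (H : SurfaceSetup m S T f K w c C) (h : ℝ) :
    ∫ y, smoothedSurface m S K w h y ∂densityMeasure f
      = ∫ x in S, w x * ∫ y, K (h⁻¹ • (x - y)) ∂densityMeasure f ∂μHE[m] := by
  have := H.isFiniteMeasure
  have := H.isProbabilityMeasure
  have hK := H.continuous_kernel
  obtain ⟨M, hM⟩ := H.hasCompactSupport_kernel.exists_bound_of_continuous H.continuous_kernel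
  simp only [smoothedSurface]
  rw [integral_integral_swap]
  · simp_rw [integral_const_mul]
  · refine Integrable.of_bound (C := C * M) ?_ (ae_of_all _ ?_)
    · exact ((H.measurable_weight.comp measurable_snd).mul
        (Continuous.measurable (by fun_prop))).aestronglyMeasurable
    · rintro ⟨y, x⟩
      simp only [Function.uncurry, norm_mul]
      exact mul_le_mul (H.weight_le x) (hM _) (norm_nonneg _) H.const_nonneg

/-- The mean of the smoothed surface measure is of order `h ^ d`. -/
lemma exists_integral_smoothedSurface_le (H : SurfaceSetup m S T f K w c C) :
    ∃ B, ∀ᶠ h : ℝ in 𝓝[>] 0,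
      |∫ y, smoothedSurface m S K w h y ∂densityMeasure f| ≤ B * h ^ d := by
  have := H.isFiniteMeasure
  have := H.isProbabilityMeasure
  have hK := H.continuous_kernel
  have hKi : Integrable K := hK.integrable_of_hasCompactSupport H.hasCompactSupport_kernel
  obtain ⟨M, hM⟩ := H.hasCompactSupport_kernel.exists_bound_of_continuous H.continuous_kernel
  obtain ⟨R, hR, hKR⟩ := exists_pos_radius H.hasCompactSupport_kernel
  obtain ⟨ρ, hρ, hfρ⟩ := H.density_near 1 one_pos
  have hL : 0 ≤ ∫ u, |K u| := integral_nonneg fun _ => abs_nonneg _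
  refine ⟨C * ((1 + |c|) * ∫ u, |K u|) * (μHE[m] : Measure (Eucl d)).real S, ?_⟩
  filter_upwards [eventually_mul_const_lt hρ R, self_mem_nhdsWithin] with h h2 (h3 : 0 < h)
  rw [H.integral_smoothedSurface]
  have hpt : ∀ x ∈ S, ‖w x * ∫ y, K (h⁻¹ • (x - y)) ∂densityMeasure f‖
      ≤ C * ((1 + |c|) * (h ^ d * ∫ u, |K u|)) := by
    intro x hx
    rw [norm_mul]
    refine mul_le_mul (H.weight_le x) ?_ (norm_nonneg _) H.const_nonneg
    have h4 := abs_integral_densityMeasure_sub_le H.measurable_density H.density_nonneg zero_le_one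
      (hfρ x hx) (g := fun y => K (h⁻¹ • (x - y))) (k := fun y => |K (h⁻¹ • (x - y))|)
      (by fun_prop) (integrable_comp_inv_smul_sub h3 hKi.abs x) (fun y => hM _) (fun y => le_rfl)
      (fun y hy => hKR _ (by
        rw [norm_smul, norm_inv, Real.norm_of_nonneg h3.le, inv_mul_eq_div, le_div_iff₀ h3,
          norm_sub_rev]
        linarith))
    rw [integral_comp_inv_smul_sub h3 (fun u => |K u|) x, one_mul,
      integral_comp_inv_smul_sub h3 K x] at h4
    have h5 : |c * (h ^ d * ∫ u, K u)| ≤ |c| * (h ^ d * ∫ u, |K u|) := by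
      rw [abs_mul, abs_mul, abs_of_pos (by positivity : 0 < h ^ d)]
      gcongr
      exact abs_integral_le_integral_abs
    have h6 := abs_add_le (∫ y, K (h⁻¹ • (x - y)) ∂densityMeasure f - c * (h ^ d * ∫ u, K u))
      (c * (h ^ d * ∫ u, K u))
    rw [sub_add_cancel] at h6
    rw [Real.norm_eq_abs]
    linarith
  refine (norm_setIntegral_le_of_norm_le_const H.measure_lt_top hpt).trans_eq ?_
  ring

end SurfaceSetup

/-! ### Central limit theorem for the integrated kernel density estimator -/

namespace SurfaceSetup

variable {d m : ℕ} {S : Set (Eucl d)} {T : Eucl d → Submodule ℝ (Eucl d)}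
  {f K w : Eucl d → ℝ} {c C : ℝ}

/-- The centred summand, with the normalization of the central limit theorem. -/
def summand (m : ℕ) (S : Set (Eucl d)) (f K w : Eucl d → ℝ) (n : ℕ) (h : ℝ) (y : Eucl d) : ℝ :=
  √(n * h) * (1 / (n * h ^ d)) *
    (smoothedSurface m S K w h y - ∫ y', smoothedSurface m S K w h y' ∂densityMeasure f)

/-- A crude bound without decay in `h`, but valid for every `h`; it serves integrability. -/
lemma abs_smoothedSurface_le (H : SurfaceSetup m S T f K w c C) {M : ℝ} (hM : ∀ z, |K z| ≤ M)
    (h : ℝ) (y : Eucl d) :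
    |smoothedSurface m S K w h y| ≤ C * M * (μHE[m] : Measure (Eucl d)).real S := by
  refine norm_setIntegral_le_of_norm_le_const (C := C * M)
    (f := fun x => w x * K (h⁻¹ • (x - y))) H.measure_lt_top fun x _ => ?_
  rw [Real.norm_eq_abs, abs_mul]
  exact mul_le_mul (H.weight_le x) (hM _) (abs_nonneg _) H.const_nonneg

lemma integrable_smoothedSurface (H : SurfaceSetup m S T f K w c C) (h : ℝ) :
    Integrable (smoothedSurface m S K w h) (densityMeasure f) := by
  have := H.isProbabilityMeasure
  obtain ⟨M, hM⟩ := H.hasCompactSupport_kernel.exists_bound_of_continuous H.continuous_kernel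
  exact Integrable.of_bound (H.measurable_smoothedSurface h).aestronglyMeasurable _
    (ae_of_all _ fun y => H.abs_smoothedSurface_le hM h y)

lemma integrable_smoothedSurface_sq (H : SurfaceSetup m S T f K w c C) (h : ℝ) :
    Integrable (fun y => smoothedSurface m S K w h y ^ 2) (densityMeasure f) := by
  have := H.isProbabilityMeasure
  obtain ⟨M, hM⟩ := H.hasCompactSupport_kernel.exists_bound_of_continuous H.continuous_kernel
  refine Integrable.of_bound ((H.measurable_smoothedSurface h).pow_const 2).aestronglyMeasurable
    ((C * M * (μHE[m] : Measure (Eucl d)).real S) ^ 2) (ae_of_all _ fun y => ?_)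
  rw [norm_pow, Real.norm_eq_abs]
  exact pow_le_pow_left₀ (abs_nonneg _) (H.abs_smoothedSurface_le hM h y) 2

lemma integral_summand (H : SurfaceSetup m S T f K w c C) (n : ℕ) (h : ℝ) :
    ∫ y, summand m S f K w n h y ∂densityMeasure f = 0 := by
  have := H.isProbabilityMeasure
  simp only [summand]
  rw [integral_const_mul, integral_sub (H.integrable_smoothedSurface h) (integrable_const _)]
  simp

/-- The normalization gives `n · nh / (n h^d)² = h / h^(2d)`, which equals `(h^m h^d)⁻¹` because `d
= m + 1`. -/
lemma nat_mul_integral_summand_sq (H : SurfaceSetup m S T f K w c C) (hd : d = m + 1) {n : ℕ}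
    (hn : n ≠ 0) {h : ℝ} (hh : 0 < h) :
    n * ∫ y, summand m S f K w n h y ^ 2 ∂densityMeasure f
      = (h ^ m * h ^ d)⁻¹ * ∫ y, smoothedSurface m S K w h y ^ 2 ∂densityMeasure f
        - (h ^ m * h ^ d)⁻¹ * (∫ y, smoothedSurface m S K w h y ∂densityMeasure f) ^ 2 := by
  have := H.isProbabilityMeasure
  set e := ∫ y, smoothedSurface m S K w h y ∂densityMeasure f with he
  have hn' : (0 : ℝ) < n := by positivity
  have h1 : ∀ y, summand m S f K w n h y ^ 2 = (n * h) * (1 / (n * h ^ d)) ^ 2 *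
      (smoothedSurface m S K w h y ^ 2 - 2 * e * smoothedSurface m S K w h y + e ^ 2) := by
    intro y
    rw [summand, mul_pow, mul_pow, Real.sq_sqrt (by positivity)]
    ring
  simp_rw [h1]
  have i1 := H.integrable_smoothedSurface_sq h
  have i2 := (H.integrable_smoothedSurface h).const_mul (2 * e)
  have i3 : Integrable (fun y => smoothedSurface m S K w h y ^ 2
      - 2 * e * smoothedSurface m S K w h y) (densityMeasure f) := i1.sub i2
  rw [integral_const_mul, integral_add i3 (integrable_const _), integral_sub i1 i2,
    integral_const_mul, ← he]
  simp only [integral_const, probReal_univ, one_smul]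
  subst hd
  field_simp
  ring

/-- The central limit theorem for the normalized summands. -/
theorem tendstoInDistribution_sum_summand (H : SurfaceSetup m S T f K w c C) (hd : d = m + 1)
    {Ω : Type*} [MeasurableSpace Ω] {P : Measure Ω} [IsProbabilityMeasure P]
    {X : ℕ → Ω → Eucl d} (hX : iIndepFun X P) (hlaw : ∀ i, HasLaw (X i) (densityMeasure f) P)
    {h : ℕ → ℝ} (hh_pos : ∀ n, 0 < h n) (hnh : Tendsto (fun n : ℕ => n * h n) atTop atTop)
    (hh : Tendsto h atTop (𝓝 0))
    (hv : 0 ≤ c * ∫ x in S, w x ^ 2 * (∫ z : T x, autocorrelation K z) ∂μHE[m]) :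
    TendstoInDistribution
      (fun (n : ℕ) ω => ∑ i ∈ Finset.range n, summand m S f K w n (h n) (X i ω)) atTop id
      (fun _ => P) (gaussianReal 0
        (c * ∫ x in S, w x ^ 2 * (∫ z : T x, autocorrelation K z) ∂μHE[m]).toNNReal) := by
  have := H.isProbabilityMeasure
  have hh' : Tendsto h atTop (𝓝[>] 0) :=
    tendsto_nhdsWithin_iff.2 ⟨hh, Eventually.of_forall hh_pos⟩
  obtain ⟨B, hB⟩ := H.exists_smoothedSurface_le
  obtain ⟨B', hB'⟩ := H.exists_integral_smoothedSurface_le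
  -- The centred smoothed surface is at most `2 B h^m`, and `√(nh) / (n h^d) · h^m = 1 / √(nh)` as
  -- `d = m + 1`.
  refine tendstoInDistribution_sum_of_bounded hX hlaw (fun n => ?_)
    (fun n => H.integral_summand n (h n)) (a := fun n => 2 * B * (√(n * h n))⁻¹) ?_ ?_ hv ?_
  · exact ((H.measurable_smoothedSurface _).sub_const _).const_mul _
  · have := (tendsto_inv_atTop_zero.comp (Real.tendsto_sqrt_atTop.comp hnh)).const_mul (2 * B)
    rw [mul_zero] at this
    exact this
  · filter_upwards [hh'.eventually hB, eventually_ne_atTop 0] with n hn hn0 y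
    have hhn := hh_pos n
    have hnpos : (0 : ℝ) < n := by positivity
    have hmean : |∫ y', smoothedSurface m S K w (h n) y' ∂densityMeasure f| ≤ B * h n ^ m := by
      refine (norm_integral_le_of_norm_le_const (μ := densityMeasure f)
        (f := smoothedSurface m S K w (h n)) (ae_of_all _ hn)).trans_eq ?_
      simp
    have hsub := (abs_sub _ _).trans (add_le_add (hn y) hmean)
    rw [summand, abs_mul, abs_of_nonneg (by positivity : 0 ≤ √(n * h n) * (1 / (n * h n ^ d)))]
    refine (mul_le_mul_of_nonneg_left hsub (by positivity)).trans_eq ?_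
    have hs : √(n * h n) * √(n * h n) = n * h n := Real.mul_self_sqrt (by positivity)
    have hs0 : 0 < √(n * h n) := Real.sqrt_pos.2 (by positivity)
    subst hd
    rw [pow_succ]
    field_simp
    rw [sq, hs]
    ring
  · have h1 := H.tendsto_integral_smoothedSurface_sq.comp hh'
    -- The squared mean is at most `B'² h^(2d)`, and `h^(2d) / (h^m h^d) = h` tends to 0.
    have h2 : Tendsto (fun n => (h n ^ m * h n ^ d)⁻¹ *
        (∫ y, smoothedSurface m S K w (h n) y ∂densityMeasure f) ^ 2) atTop (𝓝 0) := by
      have hb : Tendsto (fun n => B' ^ 2 * h n) atTop (𝓝 0) := by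
        simpa using hh.const_mul (B' ^ 2)
      refine squeeze_zero' (Eventually.of_forall fun n => ?_) ?_ hb
      · have := hh_pos n
        positivity
      · filter_upwards [hh'.eventually hB'] with n hn
        have hhn := hh_pos n
        rw [inv_mul_le_iff₀ (by positivity), ← sq_abs]
        refine (pow_le_pow_left₀ (abs_nonneg _) hn 2).trans_eq ?_
        subst hd
        ring
    have h3 := h1.sub h2
    rw [sub_zero] at h3
    refine h3.congr' ?_
    filter_upwards [eventually_ne_atTop 0] with n hn
    exact (H.nat_mul_integral_summand_sq hd hn (hh_pos n)).symm

/-! ### The kernel density estimator -/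

section KDE

variable {Ω : Type*} [MeasurableSpace Ω] {P : Measure Ω} [IsProbabilityMeasure P]
  {X : ℕ → Ω → Eucl d}

lemma kde_sub_integral (H : SurfaceSetup m S T f K w c C)
    (hlaw : ∀ i, HasLaw (X i) (densityMeasure f) P) (n : ℕ) (h : ℝ) (x : Eucl d) (ω : Ω) :
    kde K X n h x ω - ∫ ω', kde K X n h x ω' ∂P
      = ∑ i ∈ Finset.range n, 1 / (n * h ^ d) *
        (K (h⁻¹ • (x - X i ω)) - ∫ y, K (h⁻¹ • (x - y)) ∂densityMeasure f) := by
  have hK := H.continuous_kernel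
  obtain ⟨M, hM⟩ := H.hasCompactSupport_kernel.exists_bound_of_continuous hK
  have hi : ∀ i ∈ Finset.range n, Integrable (fun ω' => K (h⁻¹ • (x - X i ω'))) P := by
    intro i _
    have hm : Measurable fun y => K (h⁻¹ • (x - y)) := Continuous.measurable (by fun_prop)
    exact Integrable.of_bound (hm.comp_aemeasurable (hlaw i).aemeasurable).aestronglyMeasurable M
      (ae_of_all _ fun _ => hM _)
  have he : ∀ i ∈ Finset.range n, ∫ ω', K (h⁻¹ • (x - X i ω')) ∂P
      = ∫ y, K (h⁻¹ • (x - y)) ∂densityMeasure f := fun i _ =>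
    (hlaw i).integral_comp (f := fun y => K (h⁻¹ • (x - y)))
      (Continuous.aestronglyMeasurable (by fun_prop))
  simp only [kde]
  rw [integral_const_mul, integral_finsetSum _ hi, Finset.sum_congr rfl he, ← mul_sub,
    ← Finset.sum_sub_distrib, Finset.mul_sum]

lemma integrable_weight_mul_kernel (H : SurfaceSetup m S T f K w c C) (h : ℝ) (y : Eucl d) :
    IntegrableOn (fun x => w x * K (h⁻¹ • (x - y))) S μHE[m] := by
  have := H.isFiniteMeasure
  have hK := H.continuous_kernel
  obtain ⟨M, hM⟩ := H.hasCompactSupport_kernel.exists_bound_of_continuous hK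
  refine Integrable.of_bound (C := C * M) (H.measurable_weight.mul
    (Continuous.measurable (by fun_prop))).aestronglyMeasurable (ae_of_all _ fun x => ?_)
  rw [norm_mul]
  exact mul_le_mul (H.weight_le x) (hM _) (norm_nonneg _) H.const_nonneg

lemma integrable_weight_mul_mean_kernel (H : SurfaceSetup m S T f K w c C) (h : ℝ) :
    IntegrableOn (fun x => w x * ∫ y, K (h⁻¹ • (x - y)) ∂densityMeasure f) S μHE[m] := by
  have := H.isFiniteMeasure
  have := H.isProbabilityMeasure
  have hK := H.continuous_kernel
  obtain ⟨M, hM⟩ := H.hasCompactSupport_kernel.exists_bound_of_continuous hK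
  refine Integrable.of_bound (C := C * M) (H.measurable_weight.mul
    (StronglyMeasurable.measurable ?_)).aestronglyMeasurable (ae_of_all _ fun x => ?_)
  · exact StronglyMeasurable.integral_prod_right'
      (f := fun z : Eucl d × Eucl d => K (h⁻¹ • (z.1 - z.2)))
      (Continuous.stronglyMeasurable (by fun_prop))
  · rw [norm_mul]
    refine mul_le_mul (H.weight_le x) ?_ (norm_nonneg _) H.const_nonneg
    refine (norm_integral_le_of_norm_le_const (C := M) (ae_of_all _ fun y => hM _)).trans_eq ?_
    simp

lemma integrable_weight_mul_centred_kernel (H : SurfaceSetup m S T f K w c C) (b h : ℝ)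
    (y : Eucl d) :
    IntegrableOn (fun x => w x * (b *
      (K (h⁻¹ • (x - y)) - ∫ y', K (h⁻¹ • (x - y')) ∂densityMeasure f))) S μHE[m] := by
  refine (((H.integrable_weight_mul_kernel h y).sub
    (H.integrable_weight_mul_mean_kernel h)).const_mul b).congr (ae_of_all _ fun x => ?_)
  simp only [Pi.sub_apply]
  ring

lemma integrable_weight_mul_kde_sub (H : SurfaceSetup m S T f K w c C)
    (hlaw : ∀ i, HasLaw (X i) (densityMeasure f) P) (n : ℕ) (h : ℝ) (ω : Ω) :
    IntegrableOn (fun x => w x * (kde K X n h x ω - ∫ ω', kde K X n h x ω' ∂P)) S μHE[m] := by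
  simp_rw [H.kde_sub_integral hlaw, Finset.mul_sum]
  exact integrable_finsetSum _ fun i _ => H.integrable_weight_mul_centred_kernel _ _ _

/-- The bridge from the estimator to the limit theorem for row sums: linearity handles the kernel
terms, and Fubini (`integral_smoothedSurface`) identifies the integrated mean. -/
lemma sqrt_mul_setIntegral_kde_sub (H : SurfaceSetup m S T f K w c C)
    (hlaw : ∀ i, HasLaw (X i) (densityMeasure f) P) (n : ℕ) (h : ℝ) (ω : Ω) :
    √(n * h) * ∫ x in S, w x * (kde K X n h x ω - ∫ ω', kde K X n h x ω' ∂P) ∂μHE[m]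
      = ∑ i ∈ Finset.range n, summand m S f K w n h (X i ω) := by
  simp_rw [H.kde_sub_integral hlaw, Finset.mul_sum]
  rw [integral_finsetSum _ fun i _ => H.integrable_weight_mul_centred_kernel _ _ _,
    Finset.mul_sum]
  refine Finset.sum_congr rfl fun i _ => ?_
  have hpull : ∫ x in S, w x * (1 / (n * h ^ d) * (K (h⁻¹ • (x - X i ω))
        - ∫ y, K (h⁻¹ • (x - y)) ∂densityMeasure f)) ∂μHE[m]
      = 1 / (n * h ^ d) * ∫ x in S, (w x * K (h⁻¹ • (x - X i ω))
        - w x * ∫ y, K (h⁻¹ • (x - y)) ∂densityMeasure f) ∂μHE[m] := by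
    rw [← integral_const_mul]
    refine integral_congr_ae (ae_of_all _ fun x => ?_)
    simp only
    ring
  rw [hpull, summand, H.integral_smoothedSurface, smoothedSurface, mul_assoc,
    integral_sub (H.integrable_weight_mul_kernel h _) (H.integrable_weight_mul_mean_kernel h)]

end KDE

end SurfaceSetup

/-! ### Level sets of densities -/

/-- The set where `|f - c| ≤ η` is a neighbourhood of each point of `S`, so its interior contains a
uniform thickening of the compact set `S`. -/
lemma exists_forall_abs_sub_le_of_continuousAt {d : ℕ} {S : Set (Eucl d)} (hS : IsCompact S)
    {f : Eucl d → ℝ} {c : ℝ} (hf : ∀ x ∈ S, ContinuousAt f x) (hc : ∀ x ∈ S, f x = c) {η : ℝ}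
    (hη : 0 < η) : ∃ ρ > 0, ∀ x ∈ S, ∀ y, ‖y - x‖ < ρ → |f y - c| ≤ η := by
  have hsub : S ⊆ interior {y | |f y - c| ≤ η} := by
    intro x hx
    rw [mem_interior_iff_mem_nhds]
    filter_upwards [Metric.continuousAt_iff'.1 (hf x hx) η hη] with y hy
    rw [hc x hx, Real.dist_eq] at hy
    exact hy.le
  obtain ⟨ρ, hρ, hthick⟩ := hS.exists_thickening_subset_open isOpen_interior hsub
  refine ⟨ρ, hρ, fun x hx y hy => ?_⟩
  have hy' : y ∈ Metric.thickening ρ S :=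
    Metric.mem_thickening_iff.2 ⟨x, hx, by rwa [dist_eq_norm]⟩
  have hmem : y ∈ {y | |f y - c| ≤ η} := interior_subset (hthick hy')
  exact hmem

/-- The level set of a smooth density, its tangent spaces and a weight extended by zero form a
`SurfaceSetup`. -/
lemma surfaceSetup_levelSet {d : ℕ} {f : Eucl d → ℝ} (hf_meas : Measurable f)
    (hf_nonneg : ∀ x, 0 ≤ f x) (hprob : IsProbabilityMeasure (densityMeasure f)) {c : ℝ} {ν : ℕ}
    {K : Eucl d → ℝ} (hF1 : DensitySmoothness f c ν) (hM : IsCompact (levelSet f c))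
    (hK : KernelAssumption K ν) {w : Eucl d → ℝ} (hw_cont : ContinuousOn w (levelSet f c)) {C : ℝ}
    (hC : ∀ x ∈ levelSet f c, |w x| ≤ C) :
    (∀ x ∈ levelSet f c, gradient f x ≠ 0) ∧
    SurfaceSetup (d - 1) (levelSet f c) (tangentSpace f) f K ((levelSet f c).indicator w) c
      (max C 0) := by
  obtain ⟨δ₀, hδ₀, ε₀, hε₀, hreg⟩ := hF1
  have hν : ((ν : ℕ∞) : WithTop ℕ∞) ≠ 0 := by
    have := hK.two_le_order
    exact_mod_cast (by omega : ν ≠ 0)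
  have hval : ∀ x ∈ levelSet f c, f x = c := fun x hx => hx
  have hreg' : ∀ x ∈ levelSet f c, ContDiffAt ℝ (ν : WithTop ℕ∞) f x ∧ ε₀ < ‖gradient f x‖ := by
    intro x hx
    refine hreg x ?_
    rw [levelBand, Set.mem_preimage, hval x hx]
    constructor <;> linarith
  have hgrad : ∀ x ∈ levelSet f c, gradient f x ≠ 0 := fun x hx =>
    norm_pos_iff.1 (hε₀.trans (hreg' x hx).2)
  have hMm : MeasurableSet (levelSet f c) := hM.isClosed.measurableSet
  refine ⟨hgrad, ?_⟩
  exact {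
    isCompact := hM
    finrank_eq := fun x hx => finrank_tangentSpace (hgrad x hx)
    isTangentAt := fun x hx => by
      have hstrict := (hreg' x hx).1.hasStrictFDerivAt hν
      rw [← toDual_gradient] at hstrict
      have := isTangentAt_levelSet (hgrad x hx) hstrict
      rwa [hval x hx] at this
    measurable_density := hf_meas
    density_nonneg := hf_nonneg
    isProbabilityMeasure := hprob
    density_near := fun η hη => exists_forall_abs_sub_le_of_continuousAt hM
      (fun x hx => (hreg' x hx).1.continuousAt) hval hη
    continuous_kernel := hK.contDiff.continuous
    hasCompactSupport_kernel := hK.hasCompactSupport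
    measurable_weight := by
      classical
      rw [← Set.piecewise_eq_indicator]
      exact hw_cont.measurable_piecewise continuousOn_const hMm
    weight_le := fun x => by
      by_cases hx : x ∈ levelSet f c
      · rw [Set.indicator_of_mem hx]
        exact (hC x hx).trans (le_max_left _ _)
      · rw [Set.indicator_of_notMem hx, abs_zero]
        exact le_max_right _ _
    continuousOn_weight := hw_cont.congr fun x hx => Set.indicator_of_mem hx w }

end LevelSetKDE

end

/-! ### The central limit theorem over the level set. -/

open LevelSetKDE in
theorem mainTheorem5 {d : ℕ} (hd : 2 ≤ d)
    {Ω : Type*} [MeasurableSpace Ω] (P : Measure Ω) [IsProbabilityMeasure P]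
    (f : Eucl d → ℝ) (hf_meas : Measurable f) (hf_nonneg : ∀ x, 0 ≤ f x)
    (X : ℕ → Ω → Eucl d) (hX_indep : iIndepFun X P)
    (hX_law : ∀ i, HasLaw (X i) (volume.withDensity fun x => ENNReal.ofReal (f x)) P)
    (c : ℝ) (ν : ℕ) (K : Eucl d → ℝ)
    (hF1 : DensitySmoothness f c ν) (hM : IsCompact (levelSet f c))
    (hK : KernelAssumption K ν)
    (w : Eucl d → ℝ) (hw_cont : ContinuousOn w (levelSet f c))
    (hw_bdd : ∃ C, ∀ x ∈ levelSet f c, |w x| ≤ C)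
    (h : ℕ → ℝ) (hh_pos : ∀ n, 0 < h n)
    (hnh : Tendsto (fun n : ℕ => n * h n) atTop atTop) (hh : Tendsto h atTop (𝓝 0)) :
    IntegrableOn (fun x => w x ^ 2 * roughness f K x) (levelSet f c) μHE[d - 1] ∧
    0 ≤ c * surfaceIntegral f c (fun x => w x ^ 2 * roughness f K x) ∧
    (∀ n ω, IntegrableOn
      (fun x => w x * (kde K X n (h n) x ω - ∫ ω', kde K X n (h n) x ω' ∂P))
      (levelSet f c) μHE[d - 1]) ∧
    TendstoInDistribution
      (fun (n : ℕ) (ω : Ω) => √(n * h n) * surfaceIntegral f c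
        (fun x => w x * (kde K X n (h n) x ω - ∫ ω', kde K X n (h n) x ω' ∂P)))
      atTop id (fun _ => P)
      (gaussianReal 0
        (c * surfaceIntegral f c (fun x => w x ^ 2 * roughness f K x)).toNNReal) := by
  obtain ⟨C, hC⟩ := hw_bdd
  have hprob : IsProbabilityMeasure (densityMeasure f) := by
    rw [densityMeasure, ← (hX_law 0).map_eq]
    exact Measure.isProbabilityMeasure_map (hX_law 0).aemeasurable
  obtain ⟨hgrad, H⟩ := surfaceSetup_levelSet hf_meas hf_nonneg hprob hF1 hM hK hw_cont hC
  have hMm : MeasurableSet (levelSet f c) := H.measurableSet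
  have hrough : Set.EqOn
      (fun x => (levelSet f c).indicator w x ^ 2 * ∫ z : tangentSpace f x, autocorrelation K z)
      (fun x => w x ^ 2 * roughness f K x) (levelSet f c) := by
    intro x hx
    simp only
    rw [Set.indicator_of_mem hx, roughness_eq_integral_autocorrelation (hgrad x hx)
      H.continuous_kernel H.hasCompactSupport_kernel]
  have hvar : ∫ x in levelSet f c, (levelSet f c).indicator w x ^ 2 *
      (∫ z : tangentSpace f x, autocorrelation K z) ∂μHE[d - 1]
      = surfaceIntegral f c (fun x => w x ^ 2 * roughness f K x) :=
    setIntegral_congr_fun hMm hrough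
  have hstat : ∀ n ω, Set.EqOn
      (fun x => (levelSet f c).indicator w x *
        (kde K X n (h n) x ω - ∫ ω', kde K X n (h n) x ω' ∂P))
      (fun x => w x * (kde K X n (h n) x ω - ∫ ω', kde K X n (h n) x ω' ∂P))
      (levelSet f c) := by
    intro n ω x hx
    simp only
    rw [Set.indicator_of_mem hx]
  have hv : 0 ≤ c * surfaceIntegral f c (fun x => w x ^ 2 * roughness f K x) := by
    -- The level `c` may be negative only if the level set is empty, and then the integral is 0.
    -- Otherwise `c` is a value of the density.
    rcases (levelSet f c).eq_empty_or_nonempty with hem | ⟨x, hx⟩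
    · simp [surfaceIntegral, hem]
    · have hc : f x = c := hx
      refine mul_nonneg (hc ▸ hf_nonneg x) (setIntegral_nonneg hMm fun y _ => ?_)
      exact mul_nonneg (sq_nonneg _) (integral_nonneg fun t => sq_nonneg _)
  refine ⟨(integrableOn_congr_fun hrough hMm).1 H.integrable_sq_mul_integral_tangent, hv,
    fun n ω => (integrableOn_congr_fun (hstat n ω) hMm).1
      (H.integrable_weight_mul_kde_sub hX_law n (h n) ω), ?_⟩
  have hclt := H.tendstoInDistribution_sum_summand (by omega) hX_indep hX_law hh_pos hnh hh
    (hvar.symm ▸ hv)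
  rw [hvar] at hclt
  convert hclt using 3 with n ω
  rw [← H.sqrt_mul_setIntegral_kde_sub hX_law, surfaceIntegral,
    setIntegral_congr_fun hMm (hstat n ω)]
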